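/- Let $\beta$ be a Pisot number, i.e. a real algebraic integer $\beta>1$ all of whose other conjugates have modulus $<1$. **Notation.** $T_\beta(x)=\beta x \bmod 1$, and $d_\beta(x)=(u_i)_{i\ge1}$ with $u_i=\lfloor\beta T_\beta^{i-1}(x)\rfloor$. $\Pi_\beta^{(r)}$ is the set of rationals in $[0,1)$ whose $\beta$-expansion is purely periodic. Put $d^*_\beta(1)=d_\beta(1)$ if $d_\beta(1)$ is infinite and $d^*_\beta(1)=(t_1\cdots t_{N-1}t_N)^\infty$ if $d_\beta(1)=t_1\cdots t_{N-1}(t_N+1)0^\infty$; write $d_\beta^*(1)=t_1\cdots t_m(t_{m+1}\cdots t_n)^\infty$ with minimal preperiod and period, and $\mathcal A=\{1,\dots,n\}$. A finite string $w$ is admissible if all shifts of $w0^\infty$ are lexicographically smaller than $d^*_\beta(1)$. The admissibility graph has nodes $\mathcal A$ and edges $a\xrightarrow{\varepsilon}1$ ($0\le\varepsilon<t_a$), $a\xrightarrow{t_a}a+1$ ($a<n$), $n\xrightarrow{t_n}m+1$; $\mathcal L^{(a)}_\beta$ is the set of admissible strings labelling a path from $1$ to $a$. For $y\ge0$, $\{y\}_\beta$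 is the fractional part of $y$ in its $\beta$-expansion. $\mathbb K_\infty\cong\mathbb R^{r-1}\times\mathbb C^s$ is the product of the Archimedean completions of $\mathbb Q(\beta)$ other than the one given by $\mathbb Q(\beta)\subset\mathbb R$; $\mathbb K_f$ is the product of the completions at the prime ideals $\mathfrak P_1,\dots,\mathfrak P_\nu$ of the ring of integers that contain $\beta$; $\mathbb K_\beta=\mathbb K_\infty\times\mathbb K_f$, with embeddings $\phi_\infty,\phi_f,\phi_\beta=(\phi_\infty,\phi_f)$ of $\mathbb Q(\beta)$ and projection $\pi_\infty:\mathbb K_\beta\to\mathbb K_\infty$. For $x\in\mathbb R$, $\Delta_\infty(x)=(x,\dots,x)\in\mathbb K_\infty$, and $\Delta_\infty(E)=\{\Delta_\infty(x):x\in E\}$. $\mathbb Z_{(N(\beta))}$ is the set of rationals $p/q$ with $\gcd(q,N(\beta))=1$, $N(\beta)$ being the norm of $\beta$. Let $Z=\overline{\phi_f(\mathbb Z_{(N(\beta))})}$. The complete tiles are $$\widetilde{\mathcal T}^{(a)}=\overline{\phi_\beta\big(\{w_p\beta^p+\dots+w_0:\ w_p\cdots w_0\in\mathcal L_\beta^{(a)}\}\big)},\qquad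 \widetilde{\mathcal T}(x)=\overline{\phi_\beta(\{y\ge0:\ \{y\}_\beta=x\})}.$$ **Theorem.** Let $(u,v)$ be a non-empty open interval with $(u,v)\cap\mathbb Z_{(N(\beta))}\subset\Pi^{(r)}_\beta$. 1. If $v<1$ and $v\in\mathbb Z_{(N(\beta))}$, then $v\in\Pi_\beta^{(r)}$. If $\phi_f(\mathbb Q)$ is dense in $\mathbb K_f$, the same conclusion holds for $v<1$, $v\in\mathbb Q$ with $v$ integral at each of $\mathfrak P_1,\dots,\mathfrak P_\nu$. 2. If $(u,v)$ is maximal (for inclusion) among such intervals and $v<1$, then at least one of the following holds (they need not exclude each other): - (A) there is $a\in\mathcal A$ with $\Delta_\infty(v)\in\pi_\infty\big(-\widetilde{\mathcal T}^{(a)}\cap(\Delta_\infty(\{T_\beta^{a-1}(1)\})\times Z)\big)$ and $v=T_\beta^{a-1}(1)$; - (B) there are $a,b\in\mathcal A$ with $\Delta_\infty(v)\in\pi_\infty\big(-\widetilde{\mathcal T}^{(a)}\cap-\widetilde{\mathcal T}^{(b)}\cap(\Delta_\infty([T_\beta^{b-1}(1),T_\beta^{a-1}(1)))\times Z)\big)$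 and $T_\beta^{b-1}(1)\le v<T_\beta^{a-1}(1)$; - (C) there are $a\in\mathcal A$ and $x\in\mathbb Z[1/\beta]\cap(0,1)$ with $\Delta_\infty(v)\in\pi_\infty\big(-\widetilde{\mathcal T}^{(a)}\cap-\widetilde{\mathcal T}(x)\cap(\Delta_\infty((0,T_\beta^{a-1}(1)))\times Z)\big)$ and $v<T_\beta^{a-1}(1)$. 3. The statements 1 and 2 hold with $v$ replaced by $u$ and the condition $v<1$ replaced by $u>0$. -/

import Mathlib

open NumberField IsDedekindDomain
open scoped IntermediateField Pointwise

noncomputable section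

namespace BetaNum

/-- A Pisot number: a real algebraic integer `β > 1` all of whose other conjugates have modulus
`< 1`. -/
class IsPisot (β : ℝ) : Prop where
  one_lt : 1 < β
  isIntegral : IsIntegral ℤ β
  norm_lt_one : ∀ z : ℂ, z ∈ (minpoly ℚ β).aroots ℂ → z ≠ (β : ℂ) → ‖z‖ < 1

/-! ### Beta-numeration -/

/-- The `β`-transformation `x ↦ β x mod 1`. -/
def betaT (β x : ℝ) : ℝ := Int.fract (β * x)

/-- The digits of the `β`-expansion of `x ≥ 0`; `digit β x i` is the coefficient of
`β ^ (-(i + 1))`, i.e. the digit usually written `u_{i+1}`. -/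
def digit (β x : ℝ) (i : ℕ) : ℕ := ⌊β * (betaT β)^[i] x⌋₊

/-- The set `Π_β^{(r)}` of rational numbers in `[0,1)` with purely periodic `β`-expansion. -/
def purelyPeriodic (β : ℝ) : Set ℚ :=
  {x | 0 ≤ x ∧ x < 1 ∧ ∃ p : ℕ, 0 < p ∧ ∀ i, digit β x (i + p) = digit β x i}

/-- `d_β(1)` is finite (ends in zeros). -/
def FiniteOne (β : ℝ) : Prop := ∃ N : ℕ, ∀ i, N ≤ i → digit β 1 i = 0

/-- The length of `d_β(1)`, when it is finite. -/
def lengthOne (β : ℝ) : ℕ := sInf {N : ℕ | ∀ i, N ≤ i → digit β 1 i = 0}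

open Classical in
/-- The sequence `d*_β(1) = t_1 t_2 …`, with `t_a = dstar β (a - 1)`: it is `d_β(1)` if that is
infinite, and `(t_1 … t_{N-1} t_N)^∞` if `d_β(1) = t_1 … t_{N-1} (t_N + 1) 0^∞`. -/
def dstar (β : ℝ) (i : ℕ) : ℕ :=
  if FiniteOne β then
    if (i + 1) % lengthOne β = 0 then digit β 1 (lengthOne β - 1) - 1
    else digit β 1 (i % lengthOne β)
  else digit β 1 i

/-- The length `m` of the preperiod of `d*_β(1)`. -/
def preLen (β : ℝ) : ℕ :=
  sInf {m : ℕ | ∃ p : ℕ, 0 < p ∧ ∀ k, m ≤ k → dstar β (k + p) = dstar β k}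

/-- The length of the (minimal) period of `d*_β(1)`. -/
def perLen (β : ℝ) : ℕ :=
  sInf {p : ℕ | 0 < p ∧ ∀ k, preLen β ≤ k → dstar β (k + p) = dstar β k}

/-- The number `n` of nodes, so that `d*_β(1) = t_1 … t_m (t_{m+1} … t_n)^∞`. -/
def numNodes (β : ℝ) : ℕ := preLen β + perLen β

/-- The alphabet `𝒜 = {1, …, n}`. -/
def nodes (β : ℝ) : Set ℕ := Set.Icc 1 (numNodes β)

/-- Strict lexicographical order on sequences. -/
def LexLT (s t : ℕ → ℕ) : Prop := ∃ j, (∀ i < j, s i = t i) ∧ s j < t j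

/-- A finite string is admissible if, completed by zeros, all its shifts are lexicographically
smaller than `d*_β(1)`. -/
def Admissible (β : ℝ) (w : List ℕ) : Prop :=
  ∀ k, LexLT (fun i => w.getD (k + i) 0) (dstar β)

/-- The edges `b --ε--> a` of the admissibility graph. -/
inductive Edge (β : ℝ) : ℕ → ℕ → ℕ → Prop
  | reset {b ε : ℕ} (hb : b ∈ nodes β) (hε : ε < dstar β (b - 1)) : Edge β b ε 1
  | next {b : ℕ} (hb : b ∈ nodes β) (hn : b < numNodes β) :
      Edge β b (dstar β (b - 1)) (b + 1)
  | loop : Edge β (numNodes β) (dstar β (numNodes β - 1)) (preLen β + 1)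

/-- `Conducts β w a`: the string `w`, read from left to right, labels a path of the admissibility
graph from the initial node `1` to the node `a`. -/
inductive Conducts (β : ℝ) : List ℕ → ℕ → Prop
  | nil : Conducts β [] 1
  | snoc {w : List ℕ} {b ε a : ℕ} (hw : Conducts β w b) (he : Edge β b ε a) :
      Conducts β (w ++ [ε]) a

/-- The language `ℒ_β^{(a)}`. -/
def lang (β : ℝ) (a : ℕ) : Set (List ℕ) := {w | Admissible β w ∧ Conducts β w a}

/-- The fractional part `{y}_β` of a real `y ≥ 0`: if `β ^ (-p) y ∈ [0,1)`, the first `p` digits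
of `β ^ (-p) y` form the integer part of `y`, and the remaining ones its fractional part. -/
def fracPart (β y : ℝ) : ℝ :=
  let p := sInf {p : ℕ | y / β ^ p < 1}
  (betaT β)^[p] (y / β ^ p)

/-! ### The representation space -/

instance numberField (β : ℝ) [h : IsPisot β] : NumberField ℚ⟮β⟯ where
  to_charZero := inferInstance
  to_finiteDimensional := IntermediateField.adjoin.finiteDimensional h.isIntegral.tower_top

/-- `β` as an element of `ℚ(β)`. -/
def gen (β : ℝ) : ℚ⟮β⟯ := IntermediateField.AdjoinSimple.gen ℚ β

theorem gen_isIntegral (β : ℝ) [h : IsPisot β] : IsIntegral ℤ (gen β) := by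
  have h1 : IsIntegral ℤ (algebraMap ℚ⟮β⟯ ℝ (gen β)) := by
    simpa [gen] using h.isIntegral
  exact (isIntegral_algebraMap_iff (algebraMap ℚ⟮β⟯ ℝ).injective).1 h1

/-- `β` as an element of the ring of integers of `ℚ(β)`. -/
def genInt (β : ℝ) [IsPisot β] : 𝓞 ℚ⟮β⟯ := ⟨gen β, gen_isIntegral β⟩

/-- The Archimedean place of `ℚ(β)` given by the inclusion `ℚ(β) ⊆ ℝ`. -/
def stdPlace (β : ℝ) : InfinitePlace ℚ⟮β⟯ :=
  InfinitePlace.mk (Complex.ofRealHom.comp (algebraMap ℚ⟮β⟯ ℝ))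

/-- The Euclidean representation space `𝕂_∞ = ℝ^(r-1) × ℂ^s`: one real, resp. complex, factor for
every real, resp. complex, place other than the standard one. -/
abbrev KInf (β : ℝ) : Type :=
  ({w : InfinitePlace ℚ⟮β⟯ // w.IsReal ∧ w ≠ stdPlace β} → ℝ) ×
    ({w : InfinitePlace ℚ⟮β⟯ // w.IsComplex} → ℂ)

/-- The embedding `φ_∞`. -/
def phiInf (β : ℝ) (x : ℚ⟮β⟯) : KInf β :=
  (fun w => InfinitePlace.embedding_of_isReal w.2.1 x, fun w => w.1.embedding x)

/-- The prime ideals of the ring of integers of `ℚ(β)` that contain `β`. -/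
abbrev Primes (β : ℝ) [IsPisot β] : Type :=
  {P : HeightOneSpectrum (𝓞 ℚ⟮β⟯) // genInt β ∈ P.asIdeal}

/-- The product `𝕂_f` of the completions at the primes containing `β`. -/
abbrev KFin (β : ℝ) [IsPisot β] : Type :=
  (P : Primes β) → P.1.adicCompletion ℚ⟮β⟯

/-- The embedding `φ_f`. -/
def phiFin (β : ℝ) [IsPisot β] (x : ℚ⟮β⟯) : KFin β :=
  fun P => algebraMap ℚ⟮β⟯ (P.1.adicCompletion ℚ⟮β⟯) x

/-- The complete representation space `𝕂_β = 𝕂_∞ × 𝕂_f`. -/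
abbrev KBeta (β : ℝ) [IsPisot β] : Type := KInf β × KFin β

/-- The embedding `φ_β`. -/
def phiBeta (β : ℝ) [IsPisot β] (x : ℚ⟮β⟯) : KBeta β := (phiInf β x, phiFin β x)

/-- The projection `π_∞`. -/
def piInf (β : ℝ) [IsPisot β] (z : KBeta β) : KInf β := z.1

/-- The diagonal point `Δ_∞(x) = (x, …, x)`. -/
def diag (β : ℝ) (x : ℝ) : KInf β := (fun _ => x, fun _ => (x : ℂ))

/-- The set `ℤ_(N(β))` of rationals with denominator coprime to the norm of `β`. -/
def ZN (β : ℝ) [IsPisot β] : Set ℚ :=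
  {q | Nat.Coprime q.den (Algebra.norm ℤ (genInt β)).natAbs}

/-- The closure of `φ_f(ℤ_(N(β)))` in `𝕂_f`. -/
def closZN (β : ℝ) [IsPisot β] : Set (KFin β) :=
  closure ((fun q : ℚ => phiFin β (q : ℚ⟮β⟯)) '' ZN β)

/-! ### Complete tiles -/

/-- The complete central subtile `T̃^{(a)}`: the closure of the image by `φ_β` of the
`β`-integers `w_p β ^ p + ⋯ + w_0` whose expansion `w_p … w_0` belongs to `ℒ_β^{(a)}`. -/
def subtile (β : ℝ) [IsPisot β] (a : ℕ) : Set (KBeta β) :=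
  closure (phiBeta β '' {x | ∃ w ∈ lang β a, x = Nat.ofDigits (gen β) w.reverse})

/-- The complete `x`-tile `T̃(x)`. -/
def tile (β : ℝ) [IsPisot β] (x : ℚ⟮β⟯) : Set (KBeta β) :=
  closure (phiBeta β '' {y | 0 ≤ (y : ℝ) ∧ fracPart β (y : ℝ) = (x : ℝ)})

/-- The set `ℤ[1/β] ∩ (0,1)`. -/
def fracIndex (β : ℝ) : Set ℚ⟮β⟯ :=
  {x | x ∈ Algebra.adjoin ℤ {(gen β)⁻¹} ∧ 0 < (x : ℝ) ∧ (x : ℝ) < 1}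

/-! ### Intervals of purely periodic rationals -/

/-- `(u, v)` is a non-empty open interval with `(u, v) ∩ ℤ_(N(β)) ⊆ Π_β^{(r)}`. -/
def GoodInterval (β : ℝ) [IsPisot β] (u v : ℝ) : Prop :=
  u < v ∧ ∀ q : ℚ, q ∈ ZN β → (q : ℝ) ∈ Set.Ioo u v → q ∈ purelyPeriodic β

/-- `(u, v)` is a maximal interval with the previous property. -/
def MaximalInterval (β : ℝ) [IsPisot β] (u v : ℝ) : Prop :=
  GoodInterval β u v ∧
    ∀ u' v' : ℝ, Set.Ioo u v ⊆ Set.Ioo u' v' → GoodInterval β u' v' →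
      Set.Ioo u' v' = Set.Ioo u v

/-- Case (A) for the endpoint `e`. -/
def CaseA (β : ℝ) [IsPisot β] (e : ℝ) : Prop :=
  ∃ a ∈ nodes β,
    diag β e ∈ piInf β ''
      (-subtile β a ∩ ((diag β '' {(betaT β)^[a - 1] 1}) ×ˢ closZN β)) ∧
    e = (betaT β)^[a - 1] 1

/-- Case (B) for the endpoint `e`. -/
def CaseB (β : ℝ) [IsPisot β] (e : ℝ) : Prop :=
  ∃ a ∈ nodes β, ∃ b ∈ nodes β,
    diag β e ∈ piInf β ''
      (-subtile β a ∩ -subtile β b ∩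
        ((diag β '' Set.Ico ((betaT β)^[b - 1] 1) ((betaT β)^[a - 1] 1)) ×ˢ closZN β)) ∧
    (betaT β)^[b - 1] 1 ≤ e ∧ e < (betaT β)^[a - 1] 1

/-- Case (C) for the endpoint `e`. -/
def CaseC (β : ℝ) [IsPisot β] (e : ℝ) : Prop :=
  ∃ a ∈ nodes β, ∃ x ∈ fracIndex β,
    diag β e ∈ piInf β ''
      (-subtile β a ∩ -tile β x ∩
        ((diag β '' Set.Ioo 0 ((betaT β)^[a - 1] 1)) ×ˢ closZN β)) ∧
    e < (betaT β)^[a - 1] 1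

/-- The density condition: `φ_f(ℚ)` is dense in `𝕂_f`. -/
def DensityCondition (β : ℝ) [IsPisot β] : Prop :=
  Dense (Set.range fun q : ℚ => phiFin β (q : ℚ⟮β⟯))

/-- The rational number `q` is integral at all primes containing `β`, that is,
`q ∈ 𝔒_(β) ∩ ℚ`. -/
def IntegralAtBeta (β : ℝ) [IsPisot β] (q : ℚ) : Prop :=
  ∀ P : Primes β, P.1.valuation ℚ⟮β⟯ (q : ℚ⟮β⟯) ≤ 1

end BetaNum

end

/-!
The subtiles detect purely periodic expansions: a rational `0 ≤ q < T_β^{a-1}(1)` for which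
`-φ_β(q)` lies in the subtile of the node `a` has a purely periodic expansion, and every purely
periodic `q` arises in this way. For the first claim, prepend to `q` the words of elements of the
subtile close to `-φ_β(q)`: the resulting backward orbits of `q` stay in a finite set. For the
second, `y_k = q (β^{hk} - 1)` satisfies `φ_β(y_k) → -φ_β(q)`, as `β` is small at every place other
than the given real one. If `q ∈ ℤ_(N(β))`, then `y_k ∈ ℤ[β]` for a suitable `h`, and even when `q`
is not purely periodic the `y_k` place `-φ_β(q)` in a subtile or in one of finitely many tiles
`T̃(x)`.

The points `(q, φ_f(q))` with `q ∈ ℤ_(N(β)) ∩ I` are dense in `I × Z` for every open `I ⊆ ℝ`, so an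
endpoint of an interval of purely periodic rationals inherits a subtile over every point of `Z`. If
the interval is maximal, rationals that are not purely periodic accumulate at the endpoint, and by
compactness of `Z` the endpoint also inherits a tile from them over some point of `Z`.
-/

namespace BetaNum

open Filter Set Topology

variable {β : ℝ}

/-! ### The dynamics of the `β`-transformation -/

theorem eq_zero_of_bounded_of_succ_eq_mul {𝕜 : Type*} [NormedDivisionRing 𝕜] {c : 𝕜}
    (hc : 1 < ‖c‖) {d : ℕ → 𝕜} {C : ℝ} (hd : ∀ n, ‖d n‖ ≤ C)
    (hsucc : ∀ n, d (n + 1) = c * d n) : d 0 = 0 := by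
  have hpow (n : ℕ) : d n = c ^ n * d 0 := by
    induction n with
    | zero => simp
    | succ n ih => rw [hsucc, ih, pow_succ', mul_assoc]
  by_contra h0
  obtain ⟨n, hn⟩ := pow_unbounded_of_one_lt (C / ‖d 0‖) hc
  rw [div_lt_iff₀ (norm_pos_iff.2 h0), ← norm_pow, ← norm_mul, ← hpow] at hn
  exact (hd n).not_gt hn

theorem eq_of_mul_eq_add_succ (hβ : 1 < β) {d x y : ℕ → ℝ} (hx : ∀ i, x i ∈ Icc 0 1)
    (hy : ∀ i, y i ∈ Icc 0 1) (hdx : ∀ i, β * x i = d i + x (i + 1))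
    (hdy : ∀ i, β * y i = d i + y (i + 1)) : x 0 = y 0 := by
  refine sub_eq_zero.1 (eq_zero_of_bounded_of_succ_eq_mul (d := fun i => x i - y i) (C := 1)
    (hβ.trans_le (le_abs_self β)) (fun i => ?_) fun i => ?_)
  · rw [Real.norm_eq_abs, abs_le]
    constructor <;> linarith [(hx i).1, (hx i).2, (hy i).1, (hy i).2]
  · linarith [hdx i, hdy i]

theorem mem_periodicPts_iterate_of_finite {α : Type*} {f : α → α} {x : α} {s : Set α}
    (hs : s.Finite) {n : ℕ} (hn : s.ncard ≤ n) (hmem : ∀ i ≤ n, f^[i] x ∈ s) :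
    f^[n] x ∈ Function.periodicPts f := by
  have hcard : s.ncard < (Iic n).ncard := by
    rw [Set.ncard_eq_toFinset_card' (Iic n), Set.toFinset_Iic, Nat.card_Iic]
    omega
  obtain ⟨i, hi, j, hj, hij, heq⟩ :=
    Set.exists_ne_map_eq_of_ncard_lt_of_maps_to hcard (f := fun i => f^[i] x) hmem hs
  wlog hlt : i < j generalizing i j
  · exact this j hj i hi hij.symm heq.symm (hij.lt_or_gt.resolve_left hlt)
  refine ⟨j - i, Nat.sub_pos_of_lt hlt, ?_⟩
  rw [mem_Iic] at hi hj
  calc f^[j - i] (f^[n] x) = f^[n - i] (f^[j] x) := by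
        rw [← Function.iterate_add_apply, ← Function.iterate_add_apply]
        congr 1
        omega
    _ = f^[n - i] (f^[i] x) := by rw [← heq]
    _ = f^[n] x := by rw [← Function.iterate_add_apply, Nat.sub_add_cancel hi]

theorem betaT_mem_Ico (x : ℝ) : betaT β x ∈ Ico (0 : ℝ) 1 :=
  ⟨Int.fract_nonneg _, Int.fract_lt_one _⟩

theorem iterate_betaT_mem {s : Set ℝ} (hs : Ico 0 1 ⊆ s) {x : ℝ} (hx : x ∈ s) (i : ℕ) :
    (betaT β)^[i] x ∈ s :=
  MapsTo.iterate (fun y _ => hs (betaT_mem_Ico y)) i hx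

theorem iterate_betaT_nonneg {x : ℝ} (hx : 0 ≤ x) (i : ℕ) : 0 ≤ (betaT β)^[i] x :=
  iterate_betaT_mem Ico_subset_Ici_self hx i

theorem iterate_betaT_one_mem_Icc (i : ℕ) : (betaT β)^[i] 1 ∈ Icc (0 : ℝ) 1 :=
  iterate_betaT_mem Ico_subset_Icc_self (right_mem_Icc.2 zero_le_one) i

theorem digit_add (x : ℝ) (k i : ℕ) : digit β x (k + i) = digit β ((betaT β)^[k] x) i := by
  rw [digit, digit, ← Function.iterate_add_apply, add_comm]

theorem natFloor_mul_add_betaT (hβ : 0 ≤ β) {x : ℝ} (hx : 0 ≤ x) :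
    (⌊β * x⌋₊ : ℝ) + betaT β x = β * x := by
  rw [betaT, natCast_floor_eq_intCast_floor (mul_nonneg hβ hx), Int.floor_add_fract]

theorem mul_iterate_betaT (hβ : 0 ≤ β) {x : ℝ} (hx : 0 ≤ x) (i : ℕ) :
    β * (betaT β)^[i] x = digit β x i + (betaT β)^[i + 1] x := by
  rw [Function.iterate_succ_apply', digit, natFloor_mul_add_betaT hβ (iterate_betaT_nonneg hx i)]

theorem betaT_div_of_mem_Ico (hβ : β ≠ 0) (ε : ℕ) {x : ℝ} (hx : x ∈ Ico (0 : ℝ) 1) :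
    betaT β ((ε + x) / β) = x := by
  rw [betaT, mul_div_cancel₀ _ hβ, Int.fract_natCast_add, Int.fract_eq_self.2 hx]

theorem digit_div_of_mem_Ico (hβ : β ≠ 0) (ε : ℕ) {x : ℝ} (hx : x ∈ Ico (0 : ℝ) 1) :
    digit β ((ε + x) / β) 0 = ε := by
  rw [digit, Function.iterate_zero_apply, mul_div_cancel₀ _ hβ, add_comm,
    Nat.floor_add_natCast hx.1, Nat.floor_eq_zero.2 hx.2, zero_add]

theorem eq_of_digit_eq (hβ : 1 < β) {x y : ℝ} (hx : x ∈ Icc (0 : ℝ) 1)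
    (hy : y ∈ Icc (0 : ℝ) 1) (h : digit β x = digit β y) : x = y :=
  have hβ0 := zero_le_one.trans hβ.le
  eq_of_mul_eq_add_succ hβ (d := fun i => digit β x i)
    (iterate_betaT_mem Ico_subset_Icc_self hx) (iterate_betaT_mem Ico_subset_Icc_self hy)
    (mul_iterate_betaT hβ0 hx.1) fun i => h ▸ mul_iterate_betaT hβ0 hy.1 i

theorem mem_purelyPeriodic_iff (hβ : 1 < β) {q : ℚ} :
    q ∈ purelyPeriodic β ↔ 0 ≤ q ∧ q < 1 ∧ (q : ℝ) ∈ Function.periodicPts (betaT β) := by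
  refine and_congr_right fun h0 => and_congr_right fun h1 => exists_congr fun p =>
    and_congr_right fun _ => ?_
  have hq : (q : ℝ) ∈ Icc (0 : ℝ) 1 := by
    constructor
    · exact_mod_cast h0
    · exact_mod_cast h1.le
  constructor
  · intro h
    refine eq_of_digit_eq hβ (iterate_betaT_mem Ico_subset_Icc_self hq p) hq ?_
    funext i
    rw [← digit_add, add_comm, h]
  · intro h i
    rw [add_comm, digit_add, h]

theorem iterate_betaT_zero (i : ℕ) : (betaT β)^[i] 0 = 0 :=
  Function.iterate_fixed (by simp [betaT]) i

theorem digit_eq_zero_of_iterate_eq_zero {x : ℝ} {j : ℕ} (h : (betaT β)^[j] x = 0) {i : ℕ}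
    (hi : j ≤ i) : digit β x i = 0 := by
  obtain ⟨k, rfl⟩ := Nat.exists_eq_add_of_le hi
  rw [digit_add, h, digit, iterate_betaT_zero, mul_zero, Nat.floor_zero]

/-! ### The quasi-greedy expansion of one -/

theorem digit_eq_zero_of_lengthOne_le (h : FiniteOne β) {i : ℕ} (hi : lengthOne β ≤ i) :
    digit β 1 i = 0 :=
  Nat.sInf_mem h i hi

theorem exists_digit_ne_zero_of_lt_lengthOne {N : ℕ} (hN : N < lengthOne β) :
    ∃ i, N ≤ i ∧ digit β 1 i ≠ 0 := by
  simpa using Nat.notMem_of_lt_sInf hN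

theorem lengthOne_eq_zero_of_not_finiteOne (h : ¬ FiniteOne β) : lengthOne β = 0 := by
  rw [lengthOne, Nat.sInf_eq_zero]
  exact .inr (not_nonempty_iff_eq_empty.1 h)

theorem lengthOne_pos (hβ : 1 ≤ β) (h : FiniteOne β) : 0 < lengthOne β := by
  refine Nat.pos_of_ne_zero fun h0 => ?_
  have hdigit : digit β 1 0 = 0 := digit_eq_zero_of_lengthOne_le h h0.le
  rw [digit, Function.iterate_zero_apply, mul_one, Nat.floor_eq_zero] at hdigit
  exact hβ.not_gt hdigit

theorem digit_lengthOne_sub_one_pos (hβ : 1 ≤ β) (h : FiniteOne β) :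
    0 < digit β 1 (lengthOne β - 1) := by
  obtain ⟨i, hi, hne⟩ :=
    exists_digit_ne_zero_of_lt_lengthOne (Nat.sub_one_lt (lengthOne_pos hβ h).ne')
  have hlt : i < lengthOne β := not_le.1 fun hle => hne (digit_eq_zero_of_lengthOne_le h hle)
  rw [show lengthOne β - 1 = i by omega]
  exact Nat.pos_of_ne_zero hne

theorem iterate_lengthOne (hβ : 1 < β) (h : FiniteOne β) : (betaT β)^[lengthOne β] 1 = 0 := by
  refine eq_of_digit_eq hβ (iterate_betaT_one_mem_Icc _) (left_mem_Icc.2 zero_le_one) ?_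
  funext i
  rw [← digit_add, digit_eq_zero_of_lengthOne_le h (Nat.le_add_right _ _),
    digit_eq_zero_of_iterate_eq_zero (iterate_betaT_zero 0) i.zero_le]

variable (β) in
/-- The value of the `k`-th shift of the quasi-greedy expansion `d*_β(1)`. When `d_β(1)` is
infinite, `lengthOne β = 0` and `k % lengthOne β = k`. -/
noncomputable def dstarVal (k : ℕ) : ℝ := (betaT β)^[k % lengthOne β] 1

theorem dstarVal_mem_Icc (k : ℕ) : dstarVal β k ∈ Icc (0 : ℝ) 1 := iterate_betaT_one_mem_Icc _

theorem dstarVal_zero : dstarVal β 0 = 1 := by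
  rw [dstarVal, Nat.zero_mod, Function.iterate_zero_apply]

theorem dstarVal_pos (hβ : 1 ≤ β) (k : ℕ) : 0 < dstarVal β k := by
  refine (dstarVal_mem_Icc k).1.lt_of_ne' fun h0 => ?_
  have hdigit {i : ℕ} (hi : k % lengthOne β ≤ i) : digit β 1 i = 0 :=
    digit_eq_zero_of_iterate_eq_zero h0 hi
  have hfin : FiniteOne β := ⟨_, fun _ => hdigit⟩
  obtain ⟨i, hi, hne⟩ :=
    exists_digit_ne_zero_of_lt_lengthOne (Nat.mod_lt k (lengthOne_pos hβ hfin))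
  exact hne (hdigit hi)

theorem mul_dstarVal (hβ : 1 < β) (k : ℕ) :
    β * dstarVal β k = dstar β k + dstarVal β (k + 1) := by
  have hmul := mul_iterate_betaT (zero_le_one.trans hβ.le) zero_le_one
  unfold dstarVal dstar
  split_ifs with hfin hmod
  · have hN := lengthOne_pos hβ.le hfin
    have hlast := hmul (lengthOne β - 1)
    have hk : k % lengthOne β = lengthOne β - 1 := by
      rw [← Nat.sub_add_cancel hN] at hmod ⊢
      exact Nat.succ_mod_succ_eq_zero_iff.1 hmod
    rw [Nat.sub_add_cancel hN, iterate_lengthOne hβ hfin, add_zero] at hlast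
    rw [hk, hlast, hmod, Nat.cast_sub (digit_lengthOne_sub_one_pos hβ.le hfin), Nat.cast_one,
      Function.iterate_zero_apply, sub_add_cancel]
  · have hlt : k % lengthOne β + 1 < lengthOne β := by
      refine (Nat.succ_le_of_lt (Nat.mod_lt k (lengthOne_pos hβ.le hfin))).lt_of_ne
        fun heq => hmod ?_
      rw [← Nat.mod_add_mod, ← Nat.succ_eq_add_one, heq, Nat.mod_self]
    rw [← Nat.mod_add_mod k, Nat.mod_eq_of_lt hlt, hmul]
  · rw [lengthOne_eq_zero_of_not_finiteOne hfin, Nat.mod_zero, Nat.mod_zero, hmul]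

theorem dstarVal_eq_of_dstar_eq (hβ : 1 < β) {k l : ℕ}
    (h : ∀ i, dstar β (k + i) = dstar β (l + i)) : dstarVal β k = dstarVal β l :=
  eq_of_mul_eq_add_succ hβ (d := fun i => dstar β (k + i)) (x := fun i => dstarVal β (k + i))
    (y := fun i => dstarVal β (l + i)) (fun _ => dstarVal_mem_Icc _)
    (fun _ => dstarVal_mem_Icc _) (fun _ => mul_dstarVal hβ _)
    fun i => h i ▸ mul_dstarVal hβ _

theorem natFloor_mul_le_dstar (hβ : 1 < β) {x : ℝ} {k : ℕ} (hx : x < dstarVal β k) :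
    ⌊β * x⌋₊ ≤ dstar β k := by
  refine Nat.lt_add_one_iff.1 (Nat.floor_lt' (Nat.succ_ne_zero _) |>.2 ?_)
  calc β * x < β * dstarVal β k := mul_lt_mul_of_pos_left hx (zero_lt_one.trans hβ)
    _ = dstar β k + dstarVal β (k + 1) := mul_dstarVal hβ k
    _ ≤ (dstar β k + 1 : ℕ) := by
      push_cast
      gcongr
      exact (dstarVal_mem_Icc _).2

theorem dstar_le (hβ : 1 < β) (k : ℕ) : dstar β k ≤ β :=
  calc (dstar β k : ℝ) ≤ dstar β k + dstarVal β (k + 1) :=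
        le_add_of_nonneg_right (dstarVal_mem_Icc _).1
    _ = β * dstarVal β k := (mul_dstarVal hβ k).symm
    _ ≤ β := mul_le_of_le_one_right (zero_le_one.trans hβ.le) (dstarVal_mem_Icc k).2

theorem dstar_zero_pos (hβ : 1 < β) : 0 < dstar β 0 := by
  have hmul := mul_dstarVal hβ 0
  rw [dstarVal_zero] at hmul
  have : (0 : ℝ) < dstar β 0 := by linarith [(dstarVal_mem_Icc (β := β) (0 + 1)).2]
  exact_mod_cast this

theorem lexLT_digit_dstar (hβ : 1 < β) {x : ℝ} (hx : x ∈ Ico (0 : ℝ) 1) :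
    LexLT (digit β x) (dstar β) := by
  classical
  have hβ0 : 0 < β := zero_lt_one.trans hβ
  have hex : ∃ j, digit β x j ≠ dstar β j := by
    by_contra! hall
    refine hx.2.ne ((eq_of_mul_eq_add_succ hβ (x := fun i => (betaT β)^[i] x)
      (y := dstarVal β) (d := fun i => dstar β i)
      (iterate_betaT_mem Ico_subset_Icc_self (Ico_subset_Icc_self hx)) dstarVal_mem_Icc
      (fun i => ?_) (mul_dstarVal hβ)).trans dstarVal_zero)
    rw [mul_iterate_betaT hβ0.le hx.1, hall]
  have hlt : ∀ i ≤ Nat.find hex, (betaT β)^[i] x < dstarVal β i := by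
    intro i hi
    induction i with
    | zero => exact hx.2.trans_eq dstarVal_zero.symm
    | succ i ih =>
      have hdigit : digit β x i = dstar β i := not_not.1 (Nat.find_min hex hi)
      have hmul := mul_lt_mul_of_pos_left (ih (Nat.le_of_succ_le hi)) hβ0
      rw [mul_iterate_betaT hβ0.le hx.1, mul_dstarVal hβ, hdigit] at hmul
      exact lt_of_add_lt_add_left hmul
  exact ⟨Nat.find hex, fun i hi => not_not.1 (Nat.find_min hex hi),
    (natFloor_mul_le_dstar hβ (hlt _ le_rfl)).lt_of_ne (Nat.find_spec hex)⟩

/-! ### Parry numbers and the admissibility graph -/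

variable (β) in
/-- A Parry number: a real `β > 1` whose quasi-greedy expansion `d*_β(1)` is eventually periodic.
This is what the admissibility graph needs in order to have finitely many nodes. -/
class IsParry : Prop where
  one_lt : 1 < β
  exists_period : ∃ m p, 0 < p ∧ ∀ k, m ≤ k → dstar β (k + p) = dstar β k

theorem dstar_add_lengthOne (h : FiniteOne β) (k : ℕ) :
    dstar β (k + lengthOne β) = dstar β k := by
  unfold dstar
  rw [if_pos h, if_pos h, Nat.add_right_comm, Nat.add_mod_right, Nat.add_mod_right]

theorem Ico_dstarVal_subset (k : ℕ) : Ico 0 (dstarVal β k) ⊆ Ico 0 1 :=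
  Ico_subset_Ico_right (dstarVal_mem_Icc k).2

theorem nodes_finite : (nodes β).Finite := finite_Icc _ _

theorem Edge.le_dstar {b ε a : ℕ} (h : Edge β b ε a) : ε ≤ dstar β (b - 1) := by
  cases h with
  | reset hb hε => exact hε.le
  | next hb hn => exact le_rfl
  | loop => exact le_rfl

section Parry

variable [IsParry β]

theorem pos_of_isParry : 0 < β := zero_lt_one.trans IsParry.one_lt

theorem perLen_spec :
    0 < perLen β ∧ ∀ k, preLen β ≤ k → dstar β (k + perLen β) = dstar β k := by
  have hpre := Nat.sInf_mem (IsParry.exists_period (β := β))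
  exact Nat.sInf_mem hpre

theorem numNodes_pos : 0 < numNodes β := Nat.add_pos_right _ perLen_spec.1

theorem one_mem_nodes : 1 ∈ nodes β := ⟨le_rfl, numNodes_pos⟩

theorem dstarVal_numNodes : dstarVal β (numNodes β) = dstarVal β (preLen β) := by
  refine dstarVal_eq_of_dstar_eq IsParry.one_lt fun i => ?_
  rw [numNodes, Nat.add_right_comm]
  exact perLen_spec.2 _ (Nat.le_add_right _ _)

theorem numNodes_le_lengthOne (h : FiniteOne β) : numNodes β ≤ lengthOne β := by
  have hperiod : 0 < lengthOne β ∧ ∀ k, 0 ≤ k → dstar β (k + lengthOne β) = dstar β k :=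
    ⟨lengthOne_pos IsParry.one_lt.le h, fun k _ => dstar_add_lengthOne h k⟩
  have hpre : preLen β = 0 := Nat.le_zero.1 (Nat.sInf_le ⟨_, hperiod⟩)
  have hper : perLen β ≤ lengthOne β := Nat.sInf_le (by rwa [hpre])
  rwa [numNodes, hpre, zero_add]

theorem iterate_one_eq_dstarVal {a : ℕ} (ha : a ∈ nodes β) :
    (betaT β)^[a - 1] 1 = dstarVal β (a - 1) := by
  rw [dstarVal]
  by_cases h : FiniteOne β
  · rw [Nat.mod_eq_of_lt]
    exact (Nat.sub_one_lt (Nat.one_le_iff_ne_zero.1 ha.1)).trans_le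
      (ha.2.trans (numNodes_le_lengthOne h))
  · rw [lengthOne_eq_zero_of_not_finiteOne h, Nat.mod_zero]

theorem Edge.mem_nodes_right {b ε a : ℕ} (h : Edge β b ε a) : a ∈ nodes β := by
  cases h with
  | reset hb hε => exact one_mem_nodes
  | next hb hn => exact ⟨Nat.le_add_left _ _, hn⟩
  | loop => exact ⟨Nat.le_add_left _ _, Nat.add_le_add_left perLen_spec.1 _⟩

theorem Edge.add_dstarVal_le {b ε a : ℕ} (h : Edge β b ε a) :
    ε + dstarVal β (a - 1) ≤ β * dstarVal β (b - 1) := by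
  rw [mul_dstarVal IsParry.one_lt]
  cases h with
  | reset hb hε =>
    have hlt : (ε : ℝ) + 1 ≤ dstar β (b - 1) := by exact_mod_cast hε
    rw [Nat.sub_self, dstarVal_zero]
    linarith [(dstarVal_mem_Icc (β := β) (b - 1 + 1)).1]
  | next hb hn => rw [Nat.add_sub_cancel, Nat.sub_add_cancel hb.1]
  | loop => rw [Nat.add_sub_cancel, Nat.sub_add_cancel numNodes_pos, dstarVal_numNodes]

theorem Edge.add_div_mem_Ico {b ε a : ℕ} (h : Edge β b ε a) {x : ℝ}
    (hx : x ∈ Ico 0 (dstarVal β (a - 1))) : (ε + x) / β ∈ Ico 0 (dstarVal β (b - 1)) := by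
  have hβ : 0 < β := pos_of_isParry
  refine ⟨div_nonneg (add_nonneg ε.cast_nonneg hx.1) hβ.le, (div_lt_iff₀' hβ).2 ?_⟩
  exact (add_lt_add_right hx.2 _).trans_le h.add_dstarVal_le

theorem exists_edge {b : ℕ} (hb : b ∈ nodes β) {x : ℝ} (hx : x ∈ Ico 0 (dstarVal β (b - 1))) :
    ∃ a, Edge β b ⌊β * x⌋₊ a ∧ betaT β x < dstarVal β (a - 1) := by
  have hβ : 0 < β := pos_of_isParry
  rcases (natFloor_mul_le_dstar IsParry.one_lt hx.2).eq_or_lt with heq | hlt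
  · have hb' : betaT β x < dstarVal β b := by
      have hmul := mul_lt_mul_of_pos_left hx.2 hβ
      rw [mul_dstarVal IsParry.one_lt, Nat.sub_add_cancel hb.1,
        ← natFloor_mul_add_betaT hβ.le hx.1, heq] at hmul
      exact lt_of_add_lt_add_left hmul
    rw [heq]
    rcases hb.2.eq_or_lt with rfl | hlast
    · exact ⟨_, Edge.loop, hb'.trans_eq dstarVal_numNodes⟩
    · exact ⟨_, Edge.next hb hlast, hb'⟩
  · exact ⟨1, Edge.reset hb hlt, (betaT_mem_Ico x).2.trans_eq dstarVal_zero.symm⟩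

theorem Conducts.mem_nodes {w : List ℕ} {a : ℕ} (h : Conducts β w a) : a ∈ nodes β := by
  cases h with
  | nil => exact one_mem_nodes
  | snoc hw he => exact he.mem_nodes_right

theorem Conducts.forall_mem_le {w : List ℕ} {a : ℕ} (h : Conducts β w a) :
    ∀ ε ∈ w, (ε : ℝ) ≤ β := by
  induction h with
  | nil => simp
  | snoc hw he ih =>
    simp only [List.mem_append, List.mem_singleton]
    rintro δ (hδ | rfl)
    · exact ih δ hδ
    · exact (Nat.cast_le.2 he.le_dstar).trans (dstar_le IsParry.one_lt _)

end Parry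

/-! ### Words and `β`-integers -/

section OfDigits

variable {R : Type*} [Semiring R]

theorem ofDigits_reverse_snoc (r : R) (w : List ℕ) (ε : ℕ) :
    Nat.ofDigits r (w ++ [ε]).reverse = ε + r * Nat.ofDigits r w.reverse := by
  rw [List.reverse_concat, Nat.ofDigits]

theorem ofDigits_append_zero (r : R) (w : List ℕ) :
    Nat.ofDigits r (w ++ [0]) = Nat.ofDigits r w := by
  induction w with
  | nil => simp [Nat.ofDigits]
  | cons ε w ih => rw [List.cons_append, Nat.ofDigits, ih, Nat.ofDigits]

theorem map_ofDigits {S : Type*} [Semiring S] (f : R →+* S) (r : R) (w : List ℕ) :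
    f (Nat.ofDigits r w) = Nat.ofDigits (f r) w := by
  induction w with
  | nil => simp [Nat.ofDigits]
  | cons ε w ih => simp [Nat.ofDigits, ih]

theorem ofDigits_mem_adjoin {S : Type*} [CommRing S] (r : S) (w : List ℕ) :
    Nat.ofDigits r w ∈ Algebra.adjoin ℤ {r} := by
  induction w with
  | nil => exact zero_mem _
  | cons ε w ih =>
    exact add_mem (natCast_mem _ _) (mul_mem (Algebra.self_mem_adjoin_singleton _ _) ih)

end OfDigits

theorem coe_ofDigits_gen (w : List ℕ) :
    ((Nat.ofDigits (gen β) w : ℚ⟮β⟯) : ℝ) = Nat.ofDigits β w :=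
  map_ofDigits (algebraMap ℚ⟮β⟯ ℝ) (gen β) w

variable (β) in
/-- The word formed by the first `p` digits of the `β`-expansion of `x`. -/
noncomputable def digitWord (x : ℝ) (p : ℕ) : List ℕ := (List.range p).map (digit β x)

theorem digitWord_succ (x : ℝ) (p : ℕ) :
    digitWord β x (p + 1) = digitWord β x p ++ [digit β x p] := by
  rw [digitWord, List.range_succ, List.map_append, List.map_singleton, digitWord]

theorem pow_mul_eq_ofDigits_digitWord_add (hβ : 0 ≤ β) {x : ℝ} (hx : 0 ≤ x) (p : ℕ) :
    β ^ p * x = Nat.ofDigits β (digitWord β x p).reverse + (betaT β)^[p] x := by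
  induction p with
  | zero => simp [digitWord, Nat.ofDigits]
  | succ p ih =>
    rw [digitWord_succ, ofDigits_reverse_snoc, pow_succ', mul_assoc, ih, mul_add,
      mul_iterate_betaT hβ hx]
    ring

variable (β) in
/-- The real number whose `β`-expansion is the word `w` followed by the expansion of `x`. -/
noncomputable def prependDigits (w : List ℕ) (x : ℝ) : ℝ :=
  (Nat.ofDigits β w.reverse + x) / β ^ w.length

theorem prependDigits_nil (x : ℝ) : prependDigits β [] x = x := by
  simp [prependDigits, Nat.ofDigits]

theorem prependDigits_snoc (hβ : β ≠ 0) (w : List ℕ) (ε : ℕ) (x : ℝ) :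
    prependDigits β (w ++ [ε]) x = prependDigits β w ((ε + x) / β) := by
  rw [prependDigits, prependDigits, ofDigits_reverse_snoc, List.length_append,
    List.length_singleton, pow_succ]
  field_simp
  ring

section Parry

variable [IsParry β] {w : List ℕ} {a : ℕ} {x : ℝ}

theorem Conducts.prependDigits_mem_Ico (h : Conducts β w a)
    (hx : x ∈ Ico 0 (dstarVal β (a - 1))) : prependDigits β w x ∈ Ico (0 : ℝ) 1 := by
  induction h generalizing x with
  | nil => exact (prependDigits_nil x).symm ▸ Ico_dstarVal_subset _ hx
  | snoc _ he ih =>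
    rw [prependDigits_snoc pos_of_isParry.ne']
    exact ih (he.add_div_mem_Ico hx)

theorem Conducts.iterate_prependDigits (h : Conducts β w a)
    (hx : x ∈ Ico 0 (dstarVal β (a - 1))) : (betaT β)^[w.length] (prependDigits β w x) = x := by
  induction h generalizing x with
  | nil => exact prependDigits_nil x
  | snoc _ he ih =>
    rw [prependDigits_snoc pos_of_isParry.ne', List.length_append, List.length_singleton,
      Function.iterate_succ_apply', ih (he.add_div_mem_Ico hx),
      betaT_div_of_mem_Ico pos_of_isParry.ne' _ (Ico_dstarVal_subset _ hx)]

theorem Conducts.digit_prependDigits (h : Conducts β w a)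
    (hx : x ∈ Ico 0 (dstarVal β (a - 1))) {i : ℕ} (hi : i < w.length) :
    digit β (prependDigits β w x) i = w.getD i 0 := by
  induction h generalizing x with
  | nil => simp at hi
  | @snoc w b ε a hw he ih =>
    have hβ : β ≠ 0 := pos_of_isParry.ne'
    have hy := he.add_div_mem_Ico hx
    rw [prependDigits_snoc hβ]
    rw [List.length_append, List.length_singleton, Nat.lt_succ_iff] at hi
    rcases hi.eq_or_lt with rfl | hlt
    · rw [← add_zero w.length, digit_add, hw.iterate_prependDigits hy, add_zero,
        digit_div_of_mem_Ico hβ _ (Ico_dstarVal_subset _ hx), List.getD_append_right _ _ _ _ le_rfl,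
        Nat.sub_self, List.getD_cons_zero]
    · rw [ih hy hlt, List.getD_append _ _ _ _ hlt]

theorem Conducts.admissible (h : Conducts β w a) : Admissible β w := by
  have hzero : (0 : ℝ) ∈ Ico 0 (dstarVal β (a - 1)) :=
    left_mem_Ico.2 (dstarVal_pos IsParry.one_lt.le _)
  intro k
  have hshift : (fun i => w.getD (k + i) 0) =
      digit β ((betaT β)^[k] (prependDigits β w 0)) := by
    funext i
    rw [← digit_add]
    rcases lt_or_ge (k + i) w.length with hlt | hle
    · exact (h.digit_prependDigits hzero hlt).symm
    · rw [digit_eq_zero_of_iterate_eq_zero (h.iterate_prependDigits hzero) hle,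
        List.getD_eq_default _ _ hle]
  rw [hshift]
  exact lexLT_digit_dstar IsParry.one_lt
    (iterate_betaT_mem subset_rfl (h.prependDigits_mem_Ico hzero) k)

theorem mem_lang_iff : w ∈ lang β a ↔ Conducts β w a :=
  ⟨And.right, fun h => ⟨h.admissible, h⟩⟩

theorem Conducts.cons_zero (h : Conducts β w a) : Conducts β (0 :: w) a := by
  induction h with
  | nil => exact .snoc .nil (.reset one_mem_nodes (dstar_zero_pos IsParry.one_lt))
  | snoc _ he ih => exact .snoc ih he

theorem exists_conducts_digitWord (hx : x ∈ Ico (0 : ℝ) 1) (p : ℕ) :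
    ∃ a, Conducts β (digitWord β x p) a ∧ (betaT β)^[p] x ∈ Ico 0 (dstarVal β (a - 1)) := by
  induction p with
  | zero => exact ⟨1, .nil, hx.1, hx.2.trans_eq dstarVal_zero.symm⟩
  | succ p ih =>
    obtain ⟨b, hw, hb⟩ := ih
    obtain ⟨a, hedge, ha⟩ := exists_edge hw.mem_nodes hb
    rw [digitWord_succ, Function.iterate_succ_apply']
    exact ⟨a, hw.snoc hedge, (betaT_mem_Ico _).1, ha⟩

end Parry

variable (β) in
/-- The `β`-integers whose expansion belongs to `ℒ_β^{(a)}`; the subtile `T̃^{(a)}` is the closure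
of their image by `φ_β`. -/
def betaIntegers (a : ℕ) : Set ℚ⟮β⟯ := {x | ∃ w ∈ lang β a, x = Nat.ofDigits (gen β) w.reverse}

theorem mem_adjoin_of_mem_betaIntegers {y : ℚ⟮β⟯} {a : ℕ} (hy : y ∈ betaIntegers β a) :
    y ∈ Algebra.adjoin ℤ {gen β} := by
  obtain ⟨w, -, rfl⟩ := hy
  exact ofDigits_mem_adjoin _ _

section Parry

variable [IsParry β] {x : ℝ}

theorem exists_betaInteger_pow_mul_eq_add (hx : x ∈ Ico (0 : ℝ) 1) (p : ℕ) :
    ∃ a ∈ nodes β, ∃ y ∈ betaIntegers β a,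
      β ^ p * x = (y : ℝ) + (betaT β)^[p] x ∧ (betaT β)^[p] x ∈ Ico 0 (dstarVal β (a - 1)) := by
  obtain ⟨a, hw, ha⟩ := exists_conducts_digitWord (β := β) hx p
  refine ⟨a, hw.mem_nodes, _, ⟨_, mem_lang_iff.2 hw, rfl⟩, ?_, ha⟩
  rw [coe_ofDigits_gen, pow_mul_eq_ofDigits_digitWord_add pos_of_isParry.le hx.1]

theorem exists_betaInteger_eq_add_fracPart (hx : 0 ≤ x) :
    ∃ a ∈ nodes β, ∃ y ∈ betaIntegers β a,
      x = (y : ℝ) + fracPart β x ∧ fracPart β x ∈ Ico 0 (dstarVal β (a - 1)) := by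
  have hβ : 0 < β := pos_of_isParry
  have hne : {p : ℕ | x / β ^ p < 1}.Nonempty := by
    obtain ⟨p, hp⟩ := pow_unbounded_of_one_lt x (IsParry.one_lt (β := β))
    exact ⟨p, (div_lt_one (by positivity)).2 hp⟩
  obtain ⟨a, ha, y, hy, heq, hlt⟩ := exists_betaInteger_pow_mul_eq_add (β := β)
    ⟨by positivity, Nat.sInf_mem hne⟩ (sInf {p : ℕ | x / β ^ p < 1})
  rw [mul_div_cancel₀ _ (by positivity)] at heq
  exact ⟨a, ha, y, hy, heq, hlt⟩

theorem exists_iterate_div_pow_eq {a : ℕ} {y : ℚ⟮β⟯} (hy : y ∈ betaIntegers β a)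
    (hx : x ∈ Ico 0 (dstarVal β (a - 1))) (j : ℕ) :
    ∃ n ≥ j, ((y : ℝ) + x) / β ^ n ∈ Ico (0 : ℝ) 1 ∧
      (betaT β)^[n] (((y : ℝ) + x) / β ^ n) = x := by
  -- Leading zeros change neither `y` nor the final node, so the word of `y` can be lengthened.
  obtain ⟨w, hw, hj, hval⟩ : ∃ w, Conducts β w a ∧ j ≤ w.length ∧
      (y : ℝ) = Nat.ofDigits β w.reverse := by
    obtain ⟨w, hw, rfl⟩ := hy
    induction j with
    | zero => exact ⟨w, mem_lang_iff.1 hw, w.length.zero_le, coe_ofDigits_gen _⟩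
    | succ j ih =>
      obtain ⟨w', hw', hj, hval⟩ := ih
      exact ⟨0 :: w', hw'.cons_zero, Nat.succ_le_succ hj, by
        rw [List.reverse_cons, ofDigits_append_zero, hval]⟩
  rw [hval]
  exact ⟨w.length, hj, hw.prependDigits_mem_Ico hx, hw.iterate_prependDigits hx⟩

end Parry

/-! ### Pisot numbers are Parry numbers -/

theorem norm_ofDigits_le {R : Type*} [SeminormedRing R] {r : R} (hr : ‖r‖ < 1) {B : ℝ}
    (hB : 0 ≤ B) {w : List ℕ} (hw : ∀ ε ∈ w, ‖(ε : R)‖ ≤ B) :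
    ‖Nat.ofDigits r w‖ ≤ B / (1 - ‖r‖) := by
  have hr' : 0 < 1 - ‖r‖ := sub_pos.2 hr
  induction w with
  | nil => simpa [Nat.ofDigits] using div_nonneg hB hr'.le
  | cons ε w ih =>
    rw [List.forall_mem_cons] at hw
    calc ‖Nat.ofDigits r (ε :: w)‖
        ≤ ‖(ε : R)‖ + ‖r‖ * ‖Nat.ofDigits r w‖ := by
          rw [Nat.ofDigits]
          exact (norm_add_le _ _).trans (by gcongr; exact norm_mul_le _ _)
      _ ≤ B + ‖r‖ * (B / (1 - ‖r‖)) := by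
          gcongr
          exacts [hw.1, ih hw.2]
      _ = B / (1 - ‖r‖) := by
          field_simp
          ring

variable (β) in
/-- The embedding `φ_∞` as a ring homomorphism. -/
noncomputable def phiInfHom : ℚ⟮β⟯ →+* KInf β :=
  (RingHom.pi fun w => InfinitePlace.embedding_of_isReal w.2.1).prod
    (RingHom.pi fun w => w.1.embedding)

theorem phiInfHom_apply (x : ℚ⟮β⟯) : phiInfHom β x = phiInf β x := rfl

theorem phiInf_ratCast (q : ℚ) : phiInf β (q : ℚ⟮β⟯) = diag β q := by
  refine Prod.ext (funext fun w => ?_) (funext fun w => ?_)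
  · exact map_ratCast (InfinitePlace.embedding_of_isReal w.2.1) q
  · exact (map_ratCast w.1.embedding q).trans (Complex.ofReal_ratCast q).symm

theorem continuous_diag : Continuous (diag β) := by
  unfold diag
  fun_prop

theorem coe_gen : ((gen β : ℚ⟮β⟯) : ℝ) = β := rfl

theorem stdPlace_apply (x : ℚ⟮β⟯) : stdPlace β x = |(x : ℝ)| := by
  rw [stdPlace, InfinitePlace.apply, RingHom.comp_apply]
  exact Complex.norm_real _

theorem isReal_stdPlace : (stdPlace β).IsReal :=
  InfinitePlace.isReal_mk_iff.2 <| RingHom.ext fun _ => Complex.conj_ofReal _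

theorem isComplex_ne_stdPlace {w : InfinitePlace ℚ⟮β⟯} (hw : w.IsComplex) : w ≠ stdPlace β := by
  rintro rfl
  exact InfinitePlace.not_isReal_iff_isComplex.2 hw isReal_stdPlace

section Pisot

variable [IsPisot β]

noncomputable instance : Fintype {w : InfinitePlace ℚ⟮β⟯ // w.IsReal ∧ w ≠ stdPlace β} :=
  Fintype.ofFinite _

noncomputable instance : Fintype {w : InfinitePlace ℚ⟮β⟯ // w.IsComplex} := Fintype.ofFinite _

theorem gen_ne_zero : gen β ≠ 0 := fun h =>
  (zero_lt_one.trans (IsPisot.one_lt (β := β))).ne' (congrArg (algebraMap ℚ⟮β⟯ ℝ) h)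

theorem place_gen_lt_one {w : InfinitePlace ℚ⟮β⟯} (hw : w ≠ stdPlace β) : w (gen β) < 1 := by
  have hint : IsIntegral ℚ β := (IsPisot.isIntegral (β := β)).tower_top
  rw [← InfinitePlace.norm_embedding_eq]
  refine IsPisot.norm_lt_one (β := β) _ ((Polynomial.mem_aroots).2 ⟨minpoly.ne_zero hint, ?_⟩) ?_
  · have hroot : Polynomial.aeval (gen β) (minpoly ℚ β) = 0 := by
      rw [gen, ← IntermediateField.minpoly_gen]
      exact minpoly.aeval _ _
    exact (Polynomial.aeval_algHom_apply w.embedding.toRatAlgHom (gen β) (minpoly ℚ β)).trans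
      (by rw [hroot, map_zero])
  · intro heq
    have hext : w.embedding.toRatAlgHom =
        (Complex.ofRealHom.comp (algebraMap ℚ⟮β⟯ ℝ)).toRatAlgHom := by
      refine IntermediateField.algHom_ext_of_eq_adjoin _ (s := {β}) rfl ?_
      rintro x rfl
      exact heq
    refine hw ((InfinitePlace.mk_embedding w).symm.trans (congrArg InfinitePlace.mk ?_))
    exact RingHom.ext fun x => DFunLike.congr_fun hext x

theorem norm_phiInf_le_iff {x : ℚ⟮β⟯} {B : ℝ} (hB : 0 ≤ B) :
    ‖phiInf β x‖ ≤ B ↔ ∀ w, w ≠ stdPlace β → w x ≤ B := by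
  rw [Prod.norm_def, max_le_iff, pi_norm_le_iff_of_nonneg hB, pi_norm_le_iff_of_nonneg hB]
  constructor
  · rintro ⟨hreal, hcomplex⟩ w hw
    rcases w.isReal_or_isComplex with h | h
    · exact (InfinitePlace.norm_embedding_of_isReal h x).symm.trans_le (hreal ⟨w, h, hw⟩)
    · exact (InfinitePlace.norm_embedding_eq w x).symm.trans_le (hcomplex ⟨w, h⟩)
  · refine fun h => ⟨fun w => ?_, fun w => ?_⟩
    · exact (InfinitePlace.norm_embedding_of_isReal w.2.1 x).trans_le (h w.1 w.2.2)
    · exact (InfinitePlace.norm_embedding_eq w.1 x).trans_le (h w.1 (isComplex_ne_stdPlace w.2))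

theorem norm_phiInf_gen_lt_one : ‖phiInf β (gen β)‖ < 1 := by
  refine max_lt ((pi_norm_lt_iff one_pos).2 fun w => ?_) ((pi_norm_lt_iff one_pos).2 fun w => ?_)
  · exact (InfinitePlace.norm_embedding_of_isReal w.2.1 _).trans_lt (place_gen_lt_one w.2.2)
  · exact (InfinitePlace.norm_embedding_eq w.1 _).trans_lt
      (place_gen_lt_one (isComplex_ne_stdPlace w.2))

theorem norm_diag_le (x : ℝ) : ‖diag β x‖ ≤ |x| :=
  max_le ((pi_norm_le_iff_of_nonneg (abs_nonneg x)).2 fun _ => le_rfl)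
    ((pi_norm_le_iff_of_nonneg (abs_nonneg x)).2 fun _ => (Complex.norm_real x).le)

theorem norm_natCast_le (n : ℕ) : ‖(n : KInf β)‖ ≤ n := by
  have hn : (n : KInf β) = diag β n := by
    rw [← map_natCast (phiInfHom β), phiInfHom_apply]
    simpa using phiInf_ratCast (β := β) n
  rw [hn]
  simpa using norm_diag_le (β := β) n

variable (β) in
/-- A bound for `‖φ_∞(x)‖` over the `β`-integers `x`, namely the sum of the geometric series
bounding `∑ ε_i φ_∞(β)^i` when the digits `ε_i` are at most `β`. -/
noncomputable def conjBound : ℝ := β / (1 - ‖phiInf β (gen β)‖)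

theorem conjBound_nonneg : 0 ≤ conjBound β :=
  div_nonneg (zero_le_one.trans (IsPisot.one_lt (β := β)).le)
    (sub_nonneg.2 norm_phiInf_gen_lt_one.le)

theorem norm_phiInf_ofDigits_le {w : List ℕ} (hw : ∀ ε ∈ w, (ε : ℝ) ≤ β) :
    ‖phiInf β (Nat.ofDigits (gen β) w)‖ ≤ conjBound β := by
  rw [← phiInfHom_apply, map_ofDigits, phiInfHom_apply]
  exact norm_ofDigits_le norm_phiInf_gen_lt_one (zero_le_one.trans (IsPisot.one_lt (β := β)).le)
    fun ε hε => (norm_natCast_le ε).trans (hw ε hε)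

variable (β) in
/-- The elements of `ℚ(β)` with denominator dividing `d` all of whose Archimedean absolute values
are at most `B`. -/
def boundedElements (d : ℕ) (B : ℝ) : Set ℚ⟮β⟯ :=
  {x | IsIntegral ℤ (d * x) ∧ |(x : ℝ)| ≤ B ∧ ‖phiInf β x‖ ≤ B}

theorem boundedElements_finite {d : ℕ} (hd : d ≠ 0) (B : ℝ) : (boundedElements β d B).Finite := by
  refine Finite.of_finite_image ((Embeddings.finite_of_norm_le ℚ⟮β⟯ ℂ (d * B)).subset ?_)
    (mul_right_injective₀ (Nat.cast_ne_zero.2 hd)).injOn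
  rintro _ ⟨x, ⟨hint, hstd, hinf⟩, rfl⟩
  refine ⟨hint, fun σ => ?_⟩
  rw [map_mul, map_natCast, norm_mul, Complex.norm_natCast, ← InfinitePlace.apply]
  gcongr
  by_cases hσ : InfinitePlace.mk σ = stdPlace β
  · rwa [hσ, stdPlace_apply]
  · exact (norm_phiInf_le_iff ((abs_nonneg _).trans hstd)).1 hinf _ hσ

theorem norm_phiInf_gen_pow_le_one (k : ℕ) : ‖phiInf β (gen β ^ k)‖ ≤ 1 :=
  (norm_phiInf_le_iff zero_le_one).2 fun w hw => by
    rw [map_pow]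
    exact pow_le_one₀ (apply_nonneg w _) (place_gen_lt_one hw).le

theorem isIntegral_of_mem_adjoin_gen {x : ℚ⟮β⟯} (hx : x ∈ Algebra.adjoin ℤ {gen β}) :
    IsIntegral ℤ x :=
  adjoin_le_integralClosure (gen_isIntegral β) hx

theorem iterate_betaT_one_mem_image (k : ℕ) :
    (betaT β)^[k] 1 ∈ (fun x : ℚ⟮β⟯ => (x : ℝ)) '' boundedElements β 1 (1 + conjBound β) := by
  have hβ : 0 ≤ β := zero_le_one.trans IsPisot.one_lt.le
  let b := Nat.ofDigits (gen β) (digitWord β 1 k).reverse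
  have hcoe : ((gen β ^ k - b : ℚ⟮β⟯) : ℝ) = (betaT β)^[k] 1 := by
    push_cast
    rw [coe_ofDigits_gen, coe_gen, ← mul_one (β ^ k),
      pow_mul_eq_ofDigits_digitWord_add hβ zero_le_one, add_sub_cancel_left]
  have hword : ∀ ε ∈ (digitWord β 1 k).reverse, (ε : ℝ) ≤ β := by
    intro ε hε
    obtain ⟨i, -, rfl⟩ := List.mem_map.1 (List.mem_reverse.1 hε)
    have hmem := iterate_betaT_one_mem_Icc (β := β) i
    exact (Nat.floor_le (mul_nonneg hβ hmem.1)).trans (mul_le_of_le_one_right hβ hmem.2)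
  refine ⟨gen β ^ k - b, ⟨?_, ?_, ?_⟩, hcoe⟩
  · rw [Nat.cast_one, one_mul]
    exact ((gen_isIntegral β).pow k).sub (isIntegral_of_mem_adjoin_gen (ofDigits_mem_adjoin _ _))
  · have hmem := iterate_betaT_one_mem_Icc (β := β) k
    rw [hcoe, abs_of_nonneg hmem.1]
    exact hmem.2.trans (le_add_of_nonneg_right conjBound_nonneg)
  · rw [← phiInfHom_apply, map_sub, phiInfHom_apply, phiInfHom_apply]
    exact (norm_sub_le _ _).trans
      (add_le_add (norm_phiInf_gen_pow_le_one k) (norm_phiInf_ofDigits_le hword))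

instance : IsParry β where
  one_lt := IsPisot.one_lt
  exists_period := by
    by_cases h : FiniteOne β
    · exact ⟨0, lengthOne β, lengthOne_pos (IsPisot.one_lt (β := β)).le h,
        fun k _ => dstar_add_lengthOne h k⟩
    have hfin := ((boundedElements_finite (β := β) one_ne_zero (1 + conjBound β)).image
      fun x : ℚ⟮β⟯ => (x : ℝ))
    obtain ⟨i, j, hij, heq⟩ :=
      hfin.exists_lt_map_eq_of_forall_mem iterate_betaT_one_mem_image
    refine ⟨i, j - i, Nat.sub_pos_of_lt hij, fun k hk => ?_⟩
    obtain ⟨e, rfl⟩ := Nat.exists_eq_add_of_le hk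
    rw [dstar, dstar, if_neg h, if_neg h, Nat.add_right_comm, Nat.add_sub_cancel' hij.le,
      digit_add, digit_add, heq]

end Pisot

/-! ### Arithmetic of `ℤ_(N(β))` -/

theorem exists_mem_adjoin_mul_eq_norm (R : Type*) {S : Type*} [CommRing R] [CommRing S]
    [Algebra R S] [Module.Free R S] [Module.Finite R S] (x : S) :
    ∃ g ∈ Algebra.adjoin R {x}, x * g = algebraMap R S (Algebra.norm R x) := by
  let P := (Algebra.lmul R S x).charpoly
  have hroot : x * Polynomial.aeval x P.divX = -algebraMap R S (P.coeff 0) := by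
    have h := Algebra.aeval_self_charpoly_lmul (R := R) x
    rw [← Polynomial.divX_mul_X_add (Algebra.lmul R S x).charpoly, map_add, map_mul,
      Polynomial.aeval_X, Polynomial.aeval_C] at h
    rw [mul_comm]
    exact eq_neg_of_add_eq_zero_left h
  refine ⟨-(-1) ^ Module.finrank R S * Polynomial.aeval x P.divX,
    mul_mem (neg_mem (pow_mem (neg_mem (one_mem _)) _))
      (Polynomial.aeval_mem_adjoin_singleton _ _), ?_⟩
  rw [mul_left_comm, hroot, Algebra.norm_apply, LinearMap.det_eq_sign_charpoly_coeff, map_mul,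
    map_pow, map_neg, map_one, neg_mul_neg]

theorem exists_dvd_pow_sub_one {R : Type*} [CommRing R] {d x : R} [Finite (R ⧸ Ideal.span {d})]
    (h : IsCoprime x d) : ∃ n, 0 < n ∧ d ∣ x ^ n - 1 := by
  obtain ⟨a, b, hab⟩ := h
  have hunit : IsUnit (Ideal.Quotient.mk (Ideal.span {d}) x) := by
    refine IsUnit.of_mul_eq_one (Ideal.Quotient.mk _ a) ?_
    rw [← map_mul, ← map_one (Ideal.Quotient.mk (Ideal.span {d})), Ideal.Quotient.eq,
      Ideal.mem_span_singleton]
    exact ⟨-b, by linear_combination hab⟩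
  obtain ⟨u, hu⟩ := hunit
  obtain ⟨n, hn, hpow⟩ := (isOfFinOrder_of_finite u).exists_pow_eq_one
  refine ⟨n, hn, Ideal.mem_span_singleton.1 (Ideal.Quotient.eq.1 ?_)⟩
  rw [map_pow, ← hu, ← Units.val_pow_eq_pow_val, hpow, Units.val_one, map_one]

theorem mem_adjoin_inv_of_isIntegral {R K : Type*} [CommRing R] [Field K] [Algebra R K] {x : K}
    (hx : IsIntegral R x) : x ∈ Algebra.adjoin R {x⁻¹} := by
  rcases eq_or_ne x 0 with rfl | hx0
  · exact zero_mem _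
  obtain ⟨P, hmonic, hroot⟩ := hx
  let _ : Invertible x := invertibleOfNonzero hx0
  have hrev : Polynomial.aeval x⁻¹ P.reverse = 0 := by
    rw [← invOf_eq_inv]
    exact (Polynomial.eval₂_reverse_eq_zero_iff _ _ _).2 hroot
  rw [← Polynomial.divX_mul_X_add P.reverse, Polynomial.coeff_zero_reverse, hmonic, map_add,
    map_mul, Polynomial.aeval_X, map_one, map_one] at hrev
  have hmem := neg_mem (Polynomial.aeval_mem_adjoin_singleton R x⁻¹ (p := P.reverse.divX))
  convert hmem using 1
  linear_combination x * hrev - Polynomial.aeval x⁻¹ P.reverse.divX * mul_inv_cancel₀ hx0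

/-- The ring `ℤ_(N)` of rationals whose denominator is coprime to `N`. -/
def coprimeDen (N : ℕ) : Subring ℚ where
  carrier := {q | q.den.Coprime N}
  one_mem' := Nat.coprime_one_left N
  zero_mem' := Nat.coprime_one_left N
  mul_mem' hq hr := (hq.mul_left hr).coprime_dvd_left (Rat.mul_den_dvd _ _)
  add_mem' hq hr := (hq.mul_left hr).coprime_dvd_left (Rat.add_den_dvd _ _)
  neg_mem' hq := by rwa [mem_ofPred_eq, Rat.neg_den]

section CoprimeDen

variable {N : ℕ}

theorem mem_coprimeDen {q : ℚ} : q ∈ coprimeDen N ↔ q.den.Coprime N := Iff.rfl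

theorem div_natCast_mem_coprimeDen (i : ℤ) {d : ℕ} (hd : d.Coprime N) :
    (i / d : ℚ) ∈ coprimeDen N := by
  refine mem_coprimeDen.2 (hd.coprime_dvd_left ?_)
  have h := Rat.den_dvd i d
  rw [Rat.divInt_eq_div] at h
  exact_mod_cast h

theorem exists_lt_pow_mul_lt (hN : N ≠ 0) (k : ℕ) {a b : ℝ} (hab : a < b) :
    ∃ e ∈ coprimeDen N, ((N ^ k * e : ℚ) : ℝ) ∈ Ioo a b := by
  have hNk : (0 : ℝ) < (N : ℝ) ^ k := by positivity
  obtain ⟨j, hj⟩ := exists_nat_gt ((N : ℝ) ^ k / (b - a))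
  -- The multiples of `s = N ^ k / (j N + 1)` are `N ^ k`-multiples in `ℤ_(N)`, and `s < b - a`.
  let M := j * N + 1
  have hM : M.Coprime N := by simp [M]
  have hM0 : (0 : ℝ) < M := by positivity
  have hjM : (j : ℝ) ≤ M := by
    exact_mod_cast (Nat.le_mul_of_pos_right j (Nat.pos_of_ne_zero hN)).trans (Nat.le_succ _)
  let s : ℝ := (N : ℝ) ^ k / M
  have hs0 : 0 < s := div_pos hNk hM0
  have hs : s < b - a := by
    rw [div_lt_iff₀ (sub_pos.2 hab)] at hj
    rw [div_lt_iff₀' hM0]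
    exact hj.trans_le (mul_le_mul_of_nonneg_right hjM (sub_pos.2 hab).le)
  refine ⟨((⌊a / s⌋ + 1 : ℤ) / M : ℚ), div_natCast_mem_coprimeDen _ hM, ?_⟩
  have heq : ((N ^ k * ((⌊a / s⌋ + 1 : ℤ) / M) : ℚ) : ℝ) = (⌊a / s⌋ + 1) * s := by
    simp only [s]
    push_cast
    ring
  have hlt := (div_lt_iff₀ hs0).1 (Int.lt_floor_add_one (a / s))
  have hle := (le_div_iff₀ hs0).1 (Int.floor_le (a / s))
  rw [heq]
  exact ⟨hlt, by linarith⟩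

theorem exists_sub_natCast_eq_mul {q : ℚ} (hq : q ∈ coprimeDen N) {M : ℕ} (hM0 : 0 < M)
    (hM : q.den.Coprime M) : ∃ i < M, ∃ e ∈ coprimeDen N, q - i = M * e := by
  obtain ⟨x, y, hxy⟩ := Nat.isCoprime_iff_coprime.2 hM
  have hM0' : (0 : ℤ) < M := by exact_mod_cast hM0
  obtain ⟨i, hi⟩ := Int.eq_ofNat_of_zero_le (Int.emod_nonneg (q.num * x) hM0'.ne')
  refine ⟨i, by exact_mod_cast hi ▸ Int.emod_lt_of_pos (q.num * x) hM0',
    q * y + (q.num * x / M : ℤ),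
    add_mem (mul_mem hq (intCast_mem _ y)) (intCast_mem _ _), ?_⟩
  have hdiv : ((i : ℤ) : ℚ) + M * (q.num * x / M : ℤ) = q.num * x := by
    exact_mod_cast hi ▸ Int.emod_add_mul_ediv (q.num * x) M
  have hbezout : (x : ℚ) * q.den + y * M = 1 := by exact_mod_cast hxy
  rw [Int.cast_natCast, ← Rat.mul_den_eq_num q] at hdiv
  linear_combination -(q * hbezout) - hdiv

end CoprimeDen

section Pisot

variable [IsPisot β]

variable (β) in
/-- The absolute value `|N(β)|` of the norm of `β`, so that `ZN β` is `coprimeDen |N(β)|`. -/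
noncomputable def absNormGen : ℕ := (Algebra.norm ℤ (genInt β)).natAbs

theorem absNormGen_ne_zero : absNormGen β ≠ 0 :=
  Int.natAbs_ne_zero.2 (Algebra.norm_ne_zero_iff.2 fun h => gen_ne_zero (congrArg Subtype.val h))

theorem exists_gen_mul_eq_absNormGen :
    ∃ g ∈ Algebra.adjoin ℤ {gen β}, gen β * g = absNormGen β := by
  obtain ⟨g, hg, hmul⟩ := exists_mem_adjoin_mul_eq_norm ℤ (genInt β)
  have hg' : (g : ℚ⟮β⟯) ∈ Algebra.adjoin ℤ {gen β} := by
    have := (Subalgebra.mem_map (f := Algebra.algHom ℤ (𝓞 ℚ⟮β⟯) ℚ⟮β⟯)).2 ⟨g, hg, rfl⟩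
    rwa [AlgHom.map_adjoin_singleton] at this
  have hmul' : gen β * g = (Algebra.norm ℤ (genInt β) : ℚ⟮β⟯) := by
    have := congrArg (algebraMap (𝓞 ℚ⟮β⟯) ℚ⟮β⟯) hmul
    rwa [map_mul, eq_intCast, map_intCast] at this
  rcases Int.natAbs_eq (Algebra.norm ℤ (genInt β)) with h | h
  · exact ⟨g, hg', by rw [hmul', h, Int.cast_natCast, absNormGen]⟩
  · exact ⟨-g, neg_mem hg',
      by rw [mul_neg, hmul', h, Int.cast_neg, neg_neg, Int.cast_natCast, absNormGen]⟩

theorem exists_gen_pow_sub_one_eq {d : ℕ} (hd0 : d ≠ 0)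
    (hd : d.Coprime (absNormGen β)) :
    ∃ h, 0 < h ∧ ∃ m ∈ Algebra.adjoin ℤ {gen β}, gen β ^ h - 1 = d * m := by
  let R := Algebra.adjoin ℤ {gen β}
  let b : R := ⟨gen β, Algebra.self_mem_adjoin_singleton _ _⟩
  obtain ⟨g, hg, hgN⟩ := exists_gen_mul_eq_absNormGen (β := β)
  have hcop : IsCoprime b (d : R) := by
    have h : IsCoprime (b * ⟨g, hg⟩) (d : R) := by
      have hN : b * ⟨g, hg⟩ = (absNormGen β : R) :=
        Subtype.ext (by simpa [b] using hgN)
      rw [hN]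
      exact hd.symm.cast
    exact h.of_mul_left_left
  have : Module.Finite ℤ R := Module.Finite.iff_fg.2 (gen_isIntegral β).fg_adjoin_singleton
  have : Finite (R ⧸ Ideal.span {(d : R)}) := by
    refine Ring.HasFiniteQuotients.finiteQuotient ?_
    rw [Ne, Ideal.span_singleton_eq_bot]
    exact_mod_cast hd0
  obtain ⟨h, hpos, m, hm⟩ := exists_dvd_pow_sub_one hcop
  exact ⟨h, hpos, m, m.2, by simpa [b] using congrArg Subtype.val hm⟩

/-! ### Primes containing `β` -/

instance : Finite (Primes β) := by
  have hspan : Ideal.span {genInt β} ≠ 0 := by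
    rw [Ne, Ideal.zero_eq_bot, Ideal.span_singleton_eq_bot]
    exact fun h => gen_ne_zero (congrArg Subtype.val h)
  refine ((Ideal.finite_factors hspan).subset ?_).to_subtype (s := {P | genInt β ∈ P.asIdeal})
  exact fun P hP => Ideal.dvd_span_singleton.2 hP

theorem valuation_intCast_lt_one_iff {R K : Type*} [CommRing R] [IsDedekindDomain R] [Field K]
    [Algebra R K] [IsFractionRing R K] (P : HeightOneSpectrum R) (n : ℤ) :
    P.valuation K (n : K) < 1 ↔ n ∈ P.asIdeal.under ℤ := by
  rw [← map_intCast (algebraMap R K), HeightOneSpectrum.valuation_lt_one_iff_mem, Ideal.under,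
    Ideal.mem_comap, eq_intCast]

theorem valuation_le_one_of_isIntegral {K : Type*} [Field K] [NumberField K]
    (P : HeightOneSpectrum (𝓞 K)) {x : K} (hx : IsIntegral ℤ x) : P.valuation K x ≤ 1 :=
  P.valuation_le_one (K := K) ⟨x, hx⟩

theorem valuation_gen_lt_one (P : Primes β) : P.1.valuation ℚ⟮β⟯ (gen β) < 1 :=
  (P.1.valuation_lt_one_iff_mem (K := ℚ⟮β⟯) (genInt β)).2 P.2

theorem valuation_absNormGen_lt_one (P : Primes β) :
    P.1.valuation ℚ⟮β⟯ (absNormGen β : ℚ⟮β⟯) < 1 := by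
  obtain ⟨g, hg, hgN⟩ := exists_gen_mul_eq_absNormGen (β := β)
  rw [← hgN, map_mul]
  exact (mul_le_of_le_one_right' (valuation_le_one_of_isIntegral _
    (isIntegral_of_mem_adjoin_gen hg))).trans_lt (valuation_gen_lt_one P)

theorem exists_primes_under_eq_span {p : ℕ} (hp : p.Prime)
    (hdvd : p ∣ absNormGen β) :
    ∃ P : Primes β, P.1.asIdeal.under ℤ = Ideal.span {(p : ℤ)} := by
  rw [absNormGen, ← Ideal.absNorm_span_singleton] at hdvd
  obtain ⟨P, hmax, hunder, hgen⟩ := Ideal.exists_isMaximal_dvd_of_dvd_absNorm' hp _ hdvd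
  have hbot : P ≠ ⊥ := by
    rintro rfl
    have : (p : ℤ) ∈ (⊥ : Ideal (𝓞 ℚ⟮β⟯)).under ℤ := hunder ▸ Ideal.mem_span_singleton_self _
    rw [Ideal.under_bot, Ideal.mem_bot] at this
    exact hp.ne_zero (by exact_mod_cast this)
  exact ⟨⟨⟨P, hmax.isPrime, hbot⟩, Ideal.dvd_span_singleton.1 hgen⟩, hunder⟩

theorem mem_ZN_iff_integralAtBeta {q : ℚ} : q ∈ ZN β ↔ IntegralAtBeta β q := by
  constructor
  · intro hq P
    have hden : P.1.valuation ℚ⟮β⟯ (q.den : ℚ⟮β⟯) = 1 := by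
      refine (valuation_le_one_of_isIntegral _ (isIntegral_algebraMap (R := ℤ))).eq_of_not_lt
        fun hlt => (P.1.isPrime.under ℤ).one_notMem ?_
      obtain ⟨x, y, hxy⟩ := Nat.isCoprime_iff_coprime.2 hq
      have hmem (n : ℕ) (hn : P.1.valuation ℚ⟮β⟯ (n : ℚ⟮β⟯) < 1) : (n : ℤ) ∈ P.1.asIdeal.under ℤ :=
        (valuation_intCast_lt_one_iff (K := ℚ⟮β⟯) _ _).1 (by exact_mod_cast hn)
      rw [← hxy]
      exact add_mem (Ideal.mul_mem_left _ x (hmem _ hlt))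
        (Ideal.mul_mem_left _ y (hmem _ (valuation_absNormGen_lt_one P)))
    rw [Rat.cast_def, map_div₀, hden, div_one]
    exact valuation_le_one_of_isIntegral _ (isIntegral_algebraMap (R := ℤ))
  · intro hq
    by_contra hcop
    obtain ⟨p, hp, hden, hnorm⟩ := Nat.Prime.not_coprime_iff_dvd.1 hcop
    obtain ⟨P, hP⟩ := exists_primes_under_eq_span hp hnorm
    have hmem (n : ℤ) : P.1.valuation ℚ⟮β⟯ (n : ℚ⟮β⟯) < 1 ↔ (p : ℤ) ∣ n := by
      rw [valuation_intCast_lt_one_iff, hP, Ideal.mem_span_singleton]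
    have hnum : (p : ℤ) ∣ q.num := by
      rw [← hmem, ← Rat.cast_intCast, ← Rat.mul_den_eq_num, Rat.cast_mul, map_mul]
      refine (mul_le_of_le_one_left' (hq P)).trans_lt ?_
      exact_mod_cast (hmem q.den).2 (Int.natCast_dvd_natCast.2 hden)
    exact hp.one_lt.ne' (Nat.eq_one_of_dvd_coprimes q.reduced (Int.natCast_dvd.1 hnum) hden)

theorem isIntegral_of_isIntegral_gen_pow_mul {x : ℚ⟮β⟯} {j : ℕ}
    (hmul : IsIntegral ℤ (gen β ^ j * x)) (hval : ∀ P : Primes β, P.1.valuation ℚ⟮β⟯ x ≤ 1) :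
    IsIntegral ℤ x := by
  have hle (P : HeightOneSpectrum (𝓞 ℚ⟮β⟯)) : P.valuation ℚ⟮β⟯ x ≤ 1 := by
    by_cases hP : genInt β ∈ P.asIdeal
    · exact hval ⟨P, hP⟩
    · have hgen : P.valuation ℚ⟮β⟯ (gen β) = 1 :=
        (P.valuation_eq_one_iff_notMem (K := ℚ⟮β⟯) (r := genInt β)).2 hP
      have hle := valuation_le_one_of_isIntegral P hmul
      rwa [map_mul, map_pow, hgen, one_pow, one_mul] at hle
  obtain ⟨y, rfl⟩ := HeightOneSpectrum.mem_integers_of_valuation_le_one (R := 𝓞 ℚ⟮β⟯) ℚ⟮β⟯ x hle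
  exact y.2

end Pisot

/-! ### Topology of the representation space -/

theorem eventually_forall_pow_mul_mem {K Γ₀ : Type*} [Field K]
    [LinearOrderedCommGroupWithZero Γ₀] [MulArchimedean Γ₀] [Valued K Γ₀] {x : K}
    (hx : Valued.v x < 1) {s : Set K} (hs : s ∈ 𝓝 0) :
    ∀ᶠ k in atTop, ∀ y, Valued.v y ≤ 1 → x ^ k * y ∈ s := by
  obtain ⟨γ, hγ⟩ := Valued.mem_nhds_zero.1 hs
  have hpow := Valued.tendsto_zero_pow_of_v_lt_one hx
  filter_upwards [hpow (Valued.mem_nhds_zero.2 ⟨γ, Subset.rfl⟩)] with k hk y hy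
  refine hγ (show Valued.v.restrict (x ^ k * y) < γ from lt_of_le_of_lt ?_ hk)
  rw [Valuation.restrict_le_iff, map_mul]
  exact mul_le_of_le_one_right' hy

section Pisot

variable [IsPisot β]

theorem valued_algebraMap (P : HeightOneSpectrum (𝓞 ℚ⟮β⟯)) (x : ℚ⟮β⟯) :
    Valued.v (algebraMap ℚ⟮β⟯ (P.adicCompletion ℚ⟮β⟯) x) = P.valuation ℚ⟮β⟯ x :=
  HeightOneSpectrum.valuedAdicCompletion_eq_valuation' P x

variable (β) in
/-- The embedding `φ_f` as a ring homomorphism. -/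
noncomputable def phiFinHom : ℚ⟮β⟯ →+* KFin β :=
  RingHom.pi fun P => algebraMap ℚ⟮β⟯ (P.1.adicCompletion ℚ⟮β⟯)

theorem phiFinHom_apply (x : ℚ⟮β⟯) : phiFinHom β x = phiFin β x := rfl

variable (β) in
/-- The embedding `φ_β` as a ring homomorphism. -/
noncomputable def phiBetaHom : ℚ⟮β⟯ →+* KBeta β := (phiInfHom β).prod (phiFinHom β)

theorem phiBetaHom_apply (x : ℚ⟮β⟯) : phiBetaHom β x = phiBeta β x := rfl

theorem phiBeta_ratCast (q : ℚ) : phiBeta β q = (diag β q, phiFin β q) :=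
  Prod.ext (phiInf_ratCast q) rfl

variable (β) in
/-- The unit ball of `𝕂_f`: the product of the rings of integers of the completions. -/
def integralFin : Set (KFin β) := {z | ∀ P, Valued.v (z P) ≤ 1}

theorem phiFin_mem_integralFin_iff {x : ℚ⟮β⟯} :
    phiFin β x ∈ integralFin β ↔ ∀ P : Primes β, P.1.valuation ℚ⟮β⟯ x ≤ 1 :=
  forall_congr' fun P => by rw [phiFin, valued_algebraMap]

theorem integralFin_mem_nhds_zero : integralFin β ∈ 𝓝 0 := by
  have (P : Primes β) : {z : KFin β | Valued.v (z P) ≤ 1} ∈ 𝓝 0 :=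
    (continuous_apply P).tendsto (0 : KFin β)
      ((Valued.isOpen_integer (P.1.adicCompletion ℚ⟮β⟯)).mem_nhds (zero_mem Valued.v.integer))
  exact eventually_all.2 this

theorem eventually_forall_phiFin_pow_mul_mem {x : ℚ⟮β⟯}
    (hx : ∀ P : Primes β, P.1.valuation ℚ⟮β⟯ x < 1) {s : Set (KFin β)} (hs : s ∈ 𝓝 0) :
    ∀ᶠ k in atTop, ∀ z ∈ integralFin β, phiFinHom β x ^ k * z ∈ s := by
  rw [nhds_pi, Filter.mem_pi'] at hs
  obtain ⟨I, t, ht, hts⟩ := hs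
  have (P : Primes β) : ∀ᶠ k in atTop, ∀ y : P.1.adicCompletion ℚ⟮β⟯, Valued.v y ≤ 1 →
      algebraMap ℚ⟮β⟯ (P.1.adicCompletion ℚ⟮β⟯) x ^ k * y ∈ t P :=
    eventually_forall_pow_mul_mem ((valued_algebraMap _ _).trans_lt (hx P)) (ht P)
  filter_upwards [eventually_all.2 this] with k hk z hz
  exact hts fun P _ => hk P (z P) (hz P)

theorem tendsto_phiBetaHom_gen_pow : Tendsto (fun k => phiBetaHom β (gen β) ^ k) atTop (𝓝 0) := by
  refine (Prod.tendsto_iff _ _).2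
    ⟨tendsto_pow_atTop_nhds_zero_of_norm_lt_one norm_phiInf_gen_lt_one, ?_⟩
  refine tendsto_def.2 fun s hs => ?_
  filter_upwards [eventually_forall_phiFin_pow_mul_mem valuation_gen_lt_one hs] with k hk
  have := hk 1 fun P => (map_one _).le
  rwa [mul_one] at this

theorem tendsto_phiBeta_mul_gen_pow_sub_one (x : ℚ⟮β⟯) {h : ℕ} (hh : 0 < h) :
    Tendsto (fun k : ℕ => phiBeta β (x * (gen β ^ (h * k) - 1))) atTop (𝓝 (-phiBeta β x)) := by
  have hlim := ((tendsto_phiBetaHom_gen_pow (β := β)).comp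
    (tendsto_id.const_mul_atTop' hh)).sub_const 1 |>.const_mul (phiBetaHom β x)
  rw [zero_sub, mul_neg, mul_one] at hlim
  refine hlim.congr fun k => ?_
  rw [← phiBetaHom_apply, map_mul, map_sub, map_pow, map_one]
  rfl

/-! ### The closure of `φ_f(ℤ_(N(β)))` -/

theorem phiFin_mem_integralFin_of_mem_ZN {q : ℚ} (hq : q ∈ ZN β) : phiFin β q ∈ integralFin β :=
  phiFin_mem_integralFin_iff.2 (mem_ZN_iff_integralAtBeta.1 hq)

theorem eventually_forall_phiFin_absNormGen_pow_mul_mem {s : Set (KFin β)} (hs : s ∈ 𝓝 0) :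
    ∀ᶠ k : ℕ in atTop, ∀ e ∈ ZN β, phiFin β ((absNormGen β ^ k * e : ℚ) : ℚ⟮β⟯) ∈ s := by
  filter_upwards [eventually_forall_phiFin_pow_mul_mem valuation_absNormGen_lt_one hs]
    with k hk e he
  have := hk _ (phiFin_mem_integralFin_of_mem_ZN he)
  rwa [← phiFinHom_apply, ← map_pow, ← map_mul, phiFinHom_apply, ← Rat.cast_natCast,
    ← Rat.cast_pow, ← Rat.cast_mul] at this

theorem isCompact_closZN : IsCompact (closZN β) := by
  refine (TotallyBounded.closure ?_).isCompact_of_isClosed isClosed_closure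
  refine totallyBounded_iff_subset_finite_iUnion_nhds_zero.2 fun s hs => ?_
  obtain ⟨k, hk⟩ := (eventually_forall_phiFin_absNormGen_pow_mul_mem hs).exists
  refine ⟨(fun i : ℕ => phiFin β i) '' Iio (absNormGen β ^ k), (finite_Iio _).image _, ?_⟩
  rintro _ ⟨q, hq, rfl⟩
  obtain ⟨i, hi, e, he, heq⟩ := exists_sub_natCast_eq_mul (N := absNormGen β) hq
    (pow_pos (Nat.pos_of_ne_zero absNormGen_ne_zero) k) (Nat.Coprime.pow_right k hq)
  refine mem_biUnion (mem_image_of_mem _ hi) (mem_vadd_set.2 ⟨_, hk e he, ?_⟩)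
  rw [vadd_eq_add, ← phiFinHom_apply, ← phiFinHom_apply, ← map_add, phiFinHom_apply]
  congr 1
  rw [Nat.cast_pow] at heq
  rw [← heq]
  push_cast
  ring

/-- The embedding `q ↦ (q, φ_f(q))` of `ℚ` into `ℝ × 𝕂_f`, in which `φ_β(q)` is obtained by
repeating the real coordinate. -/
noncomputable def ratEmb (β : ℝ) [IsPisot β] (q : ℚ) : ℝ × KFin β := (q, phiFin β q)

theorem closure_prod_closZN_subset {I : Set ℝ} (hI : IsOpen I) :
    closure I ×ˢ closZN β ⊆ closure (ratEmb β '' {q | q ∈ ZN β ∧ (q : ℝ) ∈ I}) := by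
  rw [closZN, ← closure_prod_eq]
  refine closure_minimal ?_ isClosed_closure
  rintro ⟨x, _⟩ ⟨hx, q, hq, rfl⟩
  refine mem_closure_iff_nhds.2 fun W hW => ?_
  obtain ⟨U, hU, V, hV, hUV⟩ := mem_nhds_prod_iff.1 hW
  obtain ⟨a, b, hxab, hab⟩ := mem_nhds_iff_exists_Ioo_subset.1 (inter_mem hU (hI.mem_nhds hx))
  have hV0 : (fun z => phiFin β q + z) ⁻¹' V ∈ 𝓝 0 :=
    (continuous_const_add _).continuousAt.preimage_mem_nhds (by rwa [add_zero])
  obtain ⟨k, hk⟩ := (eventually_forall_phiFin_absNormGen_pow_mul_mem hV0).exists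
  obtain ⟨e, he, hlt, hgt⟩ := exists_lt_pow_mul_lt (absNormGen_ne_zero (β := β)) k
    (sub_lt_sub_right (hxab.1.trans hxab.2) (q : ℝ))
  have hmem : ((q + absNormGen β ^ k * e : ℚ) : ℝ) ∈ Ioo a b := by
    rw [Rat.cast_add]
    exact ⟨sub_lt_iff_lt_add'.1 hlt, lt_sub_iff_add_lt'.1 hgt⟩
  refine ⟨_, hUV ⟨(hab hmem).1, ?_⟩, mem_image_of_mem _ ⟨?_, (hab hmem).2⟩⟩
  · have := hk e he
    rwa [mem_preimage, ← phiFinHom_apply, ← phiFinHom_apply, ← map_add, ← Rat.cast_add] at this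
  · exact (coprimeDen _).add_mem hq (mul_mem (pow_mem (natCast_mem _ _) _) he)

end Pisot

/-! ### Tiles and purely periodic expansions -/

theorem exists_mem_closure_of_tendsto {ι κ X : Type*} [TopologicalSpace X] {s : Set ι}
    (hs : s.Finite) {A : ι → Set X} {l : Filter κ} {f : κ → X} {x : X} (hf : Tendsto f l (𝓝 x))
    (h : ∃ᶠ k in l, ∃ i ∈ s, f k ∈ A i) : ∃ i ∈ s, x ∈ closure (A i) := by
  have hmem : x ∈ closure (⋃ i ∈ s, A i) :=
    mem_closure_of_frequently_of_tendsto (h.mono fun k hk => mem_iUnion₂.2 (by simpa using hk)) hf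
  rw [hs.closure_biUnion] at hmem
  simpa using hmem

section Pisot

variable [IsPisot β] {q : ℚ} {a : ℕ}

theorem norm_phiInf_le_of_mem_betaIntegers {y : ℚ⟮β⟯} (hy : y ∈ betaIntegers β a) :
    ‖phiInf β y‖ ≤ conjBound β := by
  obtain ⟨w, hw, rfl⟩ := hy
  exact norm_phiInf_ofDigits_le fun ε hε =>
    (mem_lang_iff.1 hw).forall_mem_le ε (List.mem_reverse.1 hε)

theorem exists_subtile_of_purelyPeriodic (hq : q ∈ purelyPeriodic β) :
    ∃ a ∈ nodes β, (q : ℝ) < dstarVal β (a - 1) ∧ -phiBeta β q ∈ subtile β a := by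
  obtain ⟨h0, h1, p, hp, hperiod⟩ := (mem_purelyPeriodic_iff IsPisot.one_lt).1 hq
  have hmem (k : ℕ) : ∃ a ∈ {a ∈ nodes β | (q : ℝ) < dstarVal β (a - 1)},
      phiBeta β (q * (gen β ^ (p * k) - 1)) ∈ phiBeta β '' betaIntegers β a := by
    obtain ⟨a, ha, y, hy, heq, hlt⟩ := exists_betaInteger_pow_mul_eq_add (β := β)
      (x := q) ⟨by exact_mod_cast h0, by exact_mod_cast h1⟩ (p * k)
    rw [(hperiod.mul_const k).eq] at heq hlt
    have hy' : (q * (gen β ^ (p * k) - 1) : ℚ⟮β⟯) = y := by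
      apply Subtype.ext
      push_cast
      rw [coe_gen]
      linarith
    exact ⟨a, ⟨ha, hlt.2⟩, hy' ▸ mem_image_of_mem _ hy⟩
  obtain ⟨a, ⟨ha, hlt⟩, hcl⟩ := exists_mem_closure_of_tendsto (nodes_finite.subset (sep_subset _ _))
    (tendsto_phiBeta_mul_gen_pow_sub_one _ hp) (Eventually.of_forall hmem).frequently
  exact ⟨a, ha, hlt, hcl⟩

variable (β) in
/-- The elements of `ℤ[1/β] ∩ (0,1)` that can occur as the fractional part of an element `y` of
`ℤ[β]` with `‖φ_∞(y)‖ ≤ B`. -/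
def tileIndex (B : ℝ) : Set ℚ⟮β⟯ := boundedElements β 1 (B + conjBound β) ∩ fracIndex β

theorem tileIndex_finite (B : ℝ) : (tileIndex β B).Finite :=
  (boundedElements_finite one_ne_zero _).inter_of_left _

theorem adjoin_gen_le_adjoin_inv_gen :
    Algebra.adjoin ℤ {gen β} ≤ Algebra.adjoin ℤ {(gen β)⁻¹} :=
  Algebra.adjoin_le (singleton_subset_iff.2 (mem_adjoin_inv_of_isIntegral (gen_isIntegral β)))

theorem mem_betaIntegers_or_fracPart_mem_tileIndex {y : ℚ⟮β⟯} {B : ℝ} (hB : 1 ≤ B)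
    (hy : y ∈ Algebra.adjoin ℤ {gen β}) (h0 : 0 ≤ (y : ℝ)) (hinf : ‖phiInf β y‖ ≤ B) :
    (∃ a ∈ nodes β, y ∈ betaIntegers β a) ∨ ∃ x ∈ tileIndex β B, fracPart β y = x := by
  obtain ⟨a, ha, b, hb, heq, hfrac⟩ := exists_betaInteger_eq_add_fracPart (β := β) h0
  have hcoe : ((y - b : ℚ⟮β⟯) : ℝ) = fracPart β y := by
    push_cast
    linarith
  rcases hfrac.1.eq_or_lt with hzero | hpos
  · refine Or.inl ⟨a, ha, ?_⟩
    rwa [sub_eq_zero.1 (Subtype.ext (hcoe.trans hzero.symm) : y - b = 0)]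
  have hlt : fracPart β y < 1 := (Ico_dstarVal_subset _ hfrac).2
  have hsub : y - b ∈ Algebra.adjoin ℤ {gen β} := sub_mem hy (mem_adjoin_of_mem_betaIntegers hb)
  refine Or.inr ⟨y - b, ⟨⟨?_, ?_, ?_⟩, adjoin_gen_le_adjoin_inv_gen hsub, ?_, ?_⟩, hcoe.symm⟩
  · rw [Nat.cast_one, one_mul]
    exact isIntegral_of_mem_adjoin_gen hsub
  · rw [hcoe, abs_of_pos hpos]
    linarith [conjBound_nonneg (β := β)]
  · rw [← phiInfHom_apply, map_sub]
    exact (norm_sub_le _ _).trans (add_le_add hinf (norm_phiInf_le_of_mem_betaIntegers hb))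
  · rwa [hcoe]
  · rwa [hcoe]

theorem exists_mul_gen_pow_sub_one_mem_adjoin (hq : q ∈ ZN β) :
    ∃ h, 0 < h ∧ ∀ k, (q * (gen β ^ (h * k) - 1) : ℚ⟮β⟯) ∈ Algebra.adjoin ℤ {gen β} := by
  obtain ⟨h, hh, m, hm, heq⟩ := exists_gen_pow_sub_one_eq q.den_nz hq
  refine ⟨h, hh, fun k => ?_⟩
  have hnum : (q : ℚ⟮β⟯) * q.den = q.num := by exact_mod_cast Rat.mul_den_eq_num q
  rw [pow_mul, ← mul_geom_sum, heq, ← mul_assoc, ← mul_assoc, hnum]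
  exact mul_mem (mul_mem (intCast_mem _ _) hm)
    (sum_mem fun i _ => pow_mem (pow_mem (Algebra.self_mem_adjoin_singleton _ _) _) _)

theorem exists_subtile_or_tile (hq : q ∈ ZN β) (h0 : 0 ≤ q) (h1 : q ≤ 1) :
    (∃ a ∈ nodes β, -phiBeta β q ∈ subtile β a) ∨
      ∃ x ∈ tileIndex β 2, -phiBeta β q ∈ tile β x := by
  obtain ⟨h, hh, hadj⟩ := exists_mul_gen_pow_sub_one_mem_adjoin hq
  have h0' : (0 : ℝ) ≤ q := by exact_mod_cast h0
  have h1' : (q : ℝ) ≤ 1 := by exact_mod_cast h1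
  have hnonneg (k : ℕ) : 0 ≤ ((q * (gen β ^ (h * k) - 1) : ℚ⟮β⟯) : ℝ) := by
    push_cast
    rw [coe_gen]
    exact mul_nonneg h0' (sub_nonneg.2 (one_le_pow₀ (IsPisot.one_lt (β := β)).le))
  have hinf (k : ℕ) : ‖phiInf β (q * (gen β ^ (h * k) - 1))‖ ≤ 2 := by
    rw [← phiInfHom_apply, map_mul, map_sub, phiInfHom_apply, phiInfHom_apply, phiInf_ratCast,
      map_one]
    have hq1 : ‖diag β q‖ ≤ 1 := (norm_diag_le _).trans (by rwa [abs_of_nonneg h0'])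
    calc _ ≤ ‖diag β q‖ * (‖phiInf β (gen β ^ (h * k))‖ + ‖(1 : KInf β)‖) :=
          (norm_mul_le _ _).trans (by gcongr; exact norm_sub_le _ _)
      _ ≤ 1 * (1 + 1) := by
          gcongr
          · exact norm_phiInf_gen_pow_le_one _
          · rw [← map_one (phiInfHom β), ← pow_zero (gen β)]
            exact norm_phiInf_gen_pow_le_one 0
      _ = 2 := by norm_num
  have hlim := tendsto_phiBeta_mul_gen_pow_sub_one (β := β) q hh
  have hcover (k : ℕ) := mem_betaIntegers_or_fracPart_mem_tileIndex one_le_two (hadj k)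
    (hnonneg k) (hinf k)
  refine (frequently_or_distrib.1 (Eventually.of_forall (f := atTop) hcover).frequently).imp
    (fun hfreq => exists_mem_closure_of_tendsto nodes_finite hlim <| hfreq.mono ?_)
    (fun hfreq => exists_mem_closure_of_tendsto (tileIndex_finite 2) hlim <| hfreq.mono ?_)
  · rintro k ⟨a, ha, hy⟩
    exact ⟨a, ha, mem_image_of_mem _ hy⟩
  · rintro k ⟨x, hx, hy⟩
    exact ⟨x, hx, mem_image_of_mem _ ⟨hnonneg k, hy⟩⟩

theorem exists_add_div_gen_pow_mem_ball {x : ℚ⟮β⟯} (hx : -phiBeta β x ∈ subtile β a) (j : ℕ) :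
    ∃ y ∈ betaIntegers β a, ‖phiInf β ((y + x) / gen β ^ j)‖ ≤ 1 ∧
      phiFin β ((y + x) / gen β ^ j) ∈ integralFin β := by
  have hball : Metric.closedBall (0 : KInf β) 1 ×ˢ integralFin β ∈ 𝓝 ((0, 0) : KBeta β) :=
    prod_mem_nhds (Metric.closedBall_mem_nhds 0 one_pos) integralFin_mem_nhds_zero
  have hcont : Continuous fun z => (z + phiBeta β x) * phiBetaHom β (gen β ^ j)⁻¹ := by fun_prop
  have hnhds := hcont.tendsto (-phiBeta β x)
  rw [neg_add_cancel, zero_mul] at hnhds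
  obtain ⟨_, hz, y, hy, rfl⟩ := mem_closure_iff_nhds.1 hx _ (hnhds hball)
  rw [mem_preimage, ← phiBetaHom_apply, ← phiBetaHom_apply, ← map_add, ← map_mul,
    ← div_eq_mul_inv] at hz
  exact ⟨y, hy, mem_closedBall_zero_iff.1 hz.1, hz.2⟩

theorem isIntegral_gen_pow_mul_den_mul_add_div (q : ℚ) (j : ℕ) {y : ℚ⟮β⟯}
    (hy : y ∈ betaIntegers β a) :
    IsIntegral ℤ (gen β ^ j * (q.den * ((y + q) / gen β ^ j))) := by
  have hnum : (q : ℚ⟮β⟯) * q.den = q.num := by exact_mod_cast Rat.mul_den_eq_num q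
  have hexpand : gen β ^ j * (q.den * ((y + q) / gen β ^ j)) = q.den * y + q.num := by
    rw [← hnum]
    field_simp [gen_ne_zero (β := β)]
  rw [hexpand]
  exact isIntegral_of_mem_adjoin_gen (add_mem
    (mul_mem (natCast_mem _ _) (mem_adjoin_of_mem_betaIntegers hy)) (intCast_mem _ _))

theorem gen_pow_mul_sub_mem_boundedElements {z b : ℚ⟮β⟯} {d j : ℕ}
    (hint : IsIntegral ℤ (gen β ^ j * (d * z))) (hinf : ‖phiInf β z‖ ≤ 1)
    (hfin : phiFin β z ∈ integralFin β) (hb : b ∈ betaIntegers β a) {i : ℕ}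
    (hreal : ((gen β ^ i * z - b : ℚ⟮β⟯) : ℝ) ∈ Icc (0 : ℝ) 1) :
    gen β ^ i * z - b ∈ boundedElements β d (1 + conjBound β) := by
  have hbint : IsIntegral ℤ b := isIntegral_of_mem_adjoin_gen (mem_adjoin_of_mem_betaIntegers hb)
  have hdint : IsIntegral ℤ (d : ℚ⟮β⟯) := isIntegral_algebraMap (R := ℤ) (x := d)
  have hgint := gen_isIntegral β
  refine ⟨isIntegral_of_isIntegral_gen_pow_mul (j := j) ?_ fun P => ?_, ?_, ?_⟩
  · have hexpand : gen β ^ j * (d * (gen β ^ i * z - b)) =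
        gen β ^ i * (gen β ^ j * (d * z)) - gen β ^ j * d * b := by ring
    rw [hexpand]
    exact ((hgint.pow i).mul hint).sub (((hgint.pow j).mul hdint).mul hbint)
  · rw [map_mul]
    refine mul_le_one' (valuation_le_one_of_isIntegral _ hdint) ?_
    refine (Valuation.map_sub _ _ _).trans (max_le ?_ (valuation_le_one_of_isIntegral _ hbint))
    rw [map_mul]
    exact mul_le_one' (valuation_le_one_of_isIntegral _ (hgint.pow i))
      (phiFin_mem_integralFin_iff.1 hfin P)
  · rw [abs_of_nonneg hreal.1]
    exact hreal.2.trans (le_add_of_nonneg_right conjBound_nonneg)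
  · rw [← phiInfHom_apply, map_sub, map_mul]
    refine (norm_sub_le _ _).trans (add_le_add ((norm_mul_le _ _).trans ?_)
      (norm_phiInf_le_of_mem_betaIntegers hb))
    exact mul_le_one₀ (norm_phiInf_gen_pow_le_one i) (norm_nonneg _) hinf

/- Extending the expansion of `q` to the left by a word whose value `y` is close to `-q` in `𝕂_β`
produces `j + 1` consecutive points of the orbit leading to `q` inside a finite set that does not
depend on `j`; two of them coincide when `j` is large, and then `q` is periodic. -/
theorem purelyPeriodic_of_mem_subtile (h0 : 0 ≤ q) (hlt : (q : ℝ) < dstarVal β (a - 1))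
    (hmem : -phiBeta β q ∈ subtile β a) : q ∈ purelyPeriodic β := by
  have hqIco : (q : ℝ) ∈ Ico 0 (dstarVal β (a - 1)) := ⟨by exact_mod_cast h0, hlt⟩
  refine (mem_purelyPeriodic_iff IsPisot.one_lt).2
    ⟨h0, by exact_mod_cast (Ico_dstarVal_subset _ hqIco).2, ?_⟩
  let F : Set ℝ := (fun x : ℚ⟮β⟯ => (x : ℝ)) '' boundedElements β q.den (1 + conjBound β)
  have hF : F.Finite := (boundedElements_finite q.den_nz _).image _
  obtain ⟨y, hy, hinf, hfin⟩ := exists_add_div_gen_pow_mem_ball hmem F.ncard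
  obtain ⟨n, hn, hs, hiter⟩ := exists_iterate_div_pow_eq hy hqIco F.ncard
  set j := F.ncard
  set s : ℝ := (y + q) / β ^ n with hsdef
  have horbit (i : ℕ) : (betaT β)^[i] ((betaT β)^[n - j] s) ∈ F := by
    rw [← Function.iterate_add_apply]
    obtain ⟨c, -, b, hb, heq, hIco⟩ := exists_betaInteger_pow_mul_eq_add (β := β) hs (i + (n - j))
    have hcoe : ((gen β ^ i * ((y + q) / gen β ^ j) - b : ℚ⟮β⟯) : ℝ) =
        (betaT β)^[i + (n - j)] s := by
      have hβ : β ≠ 0 := pos_of_isParry.ne'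
      have hpow : β ^ n = β ^ (n - j) * β ^ j := by rw [← pow_add, Nat.sub_add_cancel hn]
      rw [hsdef, hpow, pow_add] at heq
      push_cast
      rw [coe_gen, hsdef, hpow, sub_eq_iff_eq_add', ← heq]
      field_simp
    refine ⟨_, gen_pow_mul_sub_mem_boundedElements
      (isIntegral_gen_pow_mul_den_mul_add_div q j hy) hinf hfin hb ?_, hcoe⟩
    rw [hcoe]
    exact Ico_subset_Icc_self (Ico_dstarVal_subset _ hIco)
  have hperiodic := mem_periodicPts_iterate_of_finite hF le_rfl fun i (_ : i ≤ j) => horbit i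
  rwa [← Function.iterate_add_apply, Nat.add_sub_cancel' hn, hiter] at hperiodic

end Pisot

/-! ### Endpoints of intervals of purely periodic rationals -/

section Pisot

variable [IsPisot β] {I : Set ℝ} {q : ℚ} {e u v : ℝ}

theorem ratCast_ne_iterate_betaT_one (h0 : 0 < q) (h1 : q < 1) (k : ℕ) :
    (q : ℝ) ≠ (betaT β)^[k] 1 := by
  intro heq
  obtain ⟨x, ⟨hint, -⟩, hx⟩ := iterate_betaT_one_mem_image (β := β) k
  have hxq : x = algebraMap ℚ ℚ⟮β⟯ q := Subtype.ext (hx.trans heq.symm)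
  rw [Nat.cast_one, one_mul, hxq,
    isIntegral_algebraMap_iff (algebraMap ℚ ℚ⟮β⟯).injective] at hint
  obtain ⟨n, rfl⟩ := IsIntegrallyClosed.isIntegral_iff.1 hint
  rw [eq_intCast, Int.cast_pos] at h0
  rw [eq_intCast, ← Int.cast_one, Int.cast_lt] at h1
  omega

theorem isClosed_setOf_diag_mem_neg {T : Set (KBeta β)} (hT : IsClosed T) :
    IsClosed {p : ℝ × KFin β | ((diag β p.1, p.2) : KBeta β) ∈ -T} :=
  hT.neg.preimage (continuous_diag.prodMap continuous_id)

theorem exists_subtile_of_mem_closure (hI : IsOpen I)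
    (hper : ∀ q ∈ ZN β, (q : ℝ) ∈ I → q ∈ purelyPeriodic β) (he : e ∈ closure I)
    {z : KFin β} (hz : z ∈ closZN β) :
    ∃ a ∈ nodes β, ((diag β e, z) : KBeta β) ∈ -subtile β a ∧ e ≤ dstarVal β (a - 1) := by
  let S (a : ℕ) : Set (ℝ × KFin β) :=
    {p | ((diag β p.1, p.2) : KBeta β) ∈ -subtile β a} ∩ {p | p.1 ≤ dstarVal β (a - 1)}
  have hclosed : IsClosed (⋃ a ∈ nodes β, S a) := nodes_finite.isClosed_biUnion fun a _ =>
    (isClosed_setOf_diag_mem_neg isClosed_closure).inter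
      (isClosed_le continuous_fst continuous_const)
  have hsub : ratEmb β '' {q | q ∈ ZN β ∧ (q : ℝ) ∈ I} ⊆ ⋃ a ∈ nodes β, S a := by
    rintro _ ⟨q, ⟨hq, hqI⟩, rfl⟩
    obtain ⟨a, ha, hlt, hmem⟩ := exists_subtile_of_purelyPeriodic (hper q hq hqI)
    rw [phiBeta_ratCast] at hmem
    exact mem_biUnion ha ⟨hmem, hlt.le⟩
  obtain ⟨a, ha, hmem⟩ := mem_iUnion₂.1
    (closure_minimal hsub hclosed (closure_prod_closZN_subset hI (mk_mem_prod he hz)))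
  exact ⟨a, ha, hmem⟩

theorem exists_mem_closZN_of_mem_closure {A : Set ℚ} (hA : A ⊆ ZN β) {C : Set (ℝ × KFin β)}
    (hC : IsClosed C) (hAC : ∀ q ∈ A, (q : ℝ) ∈ Ioo 0 1 → ratEmb β q ∈ C)
    (he : e ∈ closure (((↑) : ℚ → ℝ) '' A)) (he01 : e ∈ Ioo 0 1) : ∃ z ∈ closZN β, (e, z) ∈ C := by
  have hcompact : IsCompact (Prod.fst '' ((Icc 0 1 ×ˢ closZN β) ∩ C)) :=
    ((isCompact_Icc.prod isCompact_closZN).inter_right hC).image continuous_fst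
  have hsub : Ioo 0 1 ∩ ((↑) : ℚ → ℝ) '' A ⊆ Prod.fst '' ((Icc 0 1 ×ˢ closZN β) ∩ C) := by
    rintro _ ⟨hq, q, hqA, rfl⟩
    exact ⟨ratEmb β q, ⟨⟨Ioo_subset_Icc_self hq, subset_closure ⟨q, hA hqA, rfl⟩⟩,
      hAC q hqA hq⟩, rfl⟩
  obtain ⟨⟨_, z⟩, ⟨⟨-, hz⟩, hzC⟩, rfl⟩ :=
    closure_minimal hsub hcompact.isClosed (isOpen_Ioo.inter_closure ⟨he01, he⟩)
  exact ⟨z, hz, hzC⟩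

theorem exists_tile_of_mem_closure (h0 : 0 < e) (h1 : e < 1)
    (he : e ∈ closure (((↑) : ℚ → ℝ) '' (ZN β \ purelyPeriodic β))) :
    ∃ z ∈ closZN β,
      (∃ b ∈ nodes β, ((diag β e, z) : KBeta β) ∈ -subtile β b ∧ dstarVal β (b - 1) ≤ e) ∨
      ∃ x ∈ fracIndex β, ((diag β e, z) : KBeta β) ∈ -tile β x := by
  let S (b : ℕ) : Set (ℝ × KFin β) :=
    {p | ((diag β p.1, p.2) : KBeta β) ∈ -subtile β b} ∩ {p | dstarVal β (b - 1) ≤ p.1}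
  let S' (x : ℚ⟮β⟯) : Set (ℝ × KFin β) := {p | ((diag β p.1, p.2) : KBeta β) ∈ -tile β x}
  have hclosed : IsClosed ((⋃ b ∈ nodes β, S b) ∪ ⋃ x ∈ tileIndex β 2, S' x) := by
    refine (nodes_finite.isClosed_biUnion fun b _ => ?_).union
      ((tileIndex_finite 2).isClosed_biUnion fun x _ => ?_)
    · exact (isClosed_setOf_diag_mem_neg isClosed_closure).inter
        (isClosed_le continuous_const continuous_fst)
    · exact isClosed_setOf_diag_mem_neg isClosed_closure
  have hcover (q : ℚ) (hq : q ∈ ZN β \ purelyPeriodic β) (hq01 : (q : ℝ) ∈ Ioo 0 1) :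
      ratEmb β q ∈ (⋃ b ∈ nodes β, S b) ∪ ⋃ x ∈ tileIndex β 2, S' x := by
    have hq0 : 0 ≤ q := by exact_mod_cast hq01.1.le
    have hq1 : q ≤ 1 := by exact_mod_cast hq01.2.le
    rcases exists_subtile_or_tile hq.1 hq0 hq1 with ⟨b, hb, hmem⟩ | ⟨x, hx, hmem⟩
    · have hle : dstarVal β (b - 1) ≤ q :=
        not_lt.1 fun hlt => hq.2 (purelyPeriodic_of_mem_subtile hq0 hlt hmem)
      rw [phiBeta_ratCast] at hmem
      exact Or.inl (mem_biUnion hb ⟨hmem, hle⟩)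
    · rw [phiBeta_ratCast] at hmem
      exact Or.inr (mem_biUnion hx hmem)
  obtain ⟨z, hz, hmem | hmem⟩ :=
    exists_mem_closZN_of_mem_closure sdiff_subset hclosed hcover he ⟨h0, h1⟩
  · obtain ⟨b, hb, hmem⟩ := mem_iUnion₂.1 hmem
    exact ⟨z, hz, Or.inl ⟨b, hb, hmem⟩⟩
  · obtain ⟨x, hx, hmem⟩ := mem_iUnion₂.1 hmem
    exact ⟨z, hz, Or.inr ⟨x, hx.2, hmem⟩⟩

theorem purelyPeriodic_of_mem_closure (hI : IsOpen I)
    (hper : ∀ q ∈ ZN β, (q : ℝ) ∈ I → q ∈ purelyPeriodic β) (hq : q ∈ ZN β)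
    (hqI : (q : ℝ) ∈ closure I) (h0 : 0 < q) (h1 : q < 1) : q ∈ purelyPeriodic β := by
  obtain ⟨a, ha, hmem, hle⟩ :=
    exists_subtile_of_mem_closure hI hper hqI (subset_closure (mem_image_of_mem _ hq))
  rw [← phiBeta_ratCast] at hmem
  refine purelyPeriodic_of_mem_subtile h0.le (hle.lt_of_ne ?_) hmem
  rw [← iterate_one_eq_dstarVal ha]
  exact ratCast_ne_iterate_betaT_one h0 h1 _

theorem caseA_or_caseB_or_caseC_of_mem_closure (hI : IsOpen I)
    (hper : ∀ q ∈ ZN β, (q : ℝ) ∈ I → q ∈ purelyPeriodic β) (heI : e ∈ closure I)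
    (he : e ∈ closure (((↑) : ℚ → ℝ) '' (ZN β \ purelyPeriodic β))) (h0 : 0 < e) (h1 : e < 1) :
    CaseA β e ∨ CaseB β e ∨ CaseC β e := by
  obtain ⟨z, hz, htile⟩ := exists_tile_of_mem_closure h0 h1 he
  obtain ⟨a, ha, hmem, hle⟩ := exists_subtile_of_mem_closure hI hper heI hz
  rw [← iterate_one_eq_dstarVal ha] at hle
  rcases hle.eq_or_lt with heq | hlt
  · exact Or.inl ⟨a, ha, ⟨_, ⟨hmem, mem_image_of_mem _ heq, hz⟩, rfl⟩, heq⟩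
  rcases htile with ⟨b, hb, hmemb, hleb⟩ | ⟨x, hx, hmemx⟩
  · rw [← iterate_one_eq_dstarVal hb] at hleb
    exact Or.inr <| Or.inl ⟨a, ha, b, hb,
      ⟨_, ⟨⟨hmem, hmemb⟩, mem_image_of_mem _ ⟨hleb, hlt⟩, hz⟩, rfl⟩, hleb, hlt⟩
  · exact Or.inr <| Or.inr ⟨a, ha, x, hx,
      ⟨_, ⟨⟨hmem, hmemx⟩, mem_image_of_mem _ ⟨h0, hlt⟩, hz⟩, rfl⟩, hlt⟩

theorem GoodInterval.exists_purelyPeriodic_mem (h : GoodInterval β u v) :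
    ∃ q ∈ purelyPeriodic β, (q : ℝ) ∈ Ioo u v := by
  obtain ⟨e, he, hmem⟩ := exists_lt_pow_mul_lt (absNormGen_ne_zero (β := β)) 0 h.1
  rw [pow_zero, one_mul] at hmem
  exact ⟨e, h.2 e he hmem, hmem⟩

theorem GoodInterval.right_pos (h : GoodInterval β u v) : 0 < v := by
  obtain ⟨q, ⟨h0, -⟩, hq⟩ := h.exists_purelyPeriodic_mem
  exact (Rat.cast_nonneg.2 h0).trans_lt hq.2

theorem GoodInterval.left_lt_one (h : GoodInterval β u v) : u < 1 := by
  obtain ⟨q, ⟨-, h1, -⟩, hq⟩ := h.exists_purelyPeriodic_mem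
  exact hq.1.trans (by exact_mod_cast h1)

theorem GoodInterval.closure_Ioo (h : GoodInterval β u v) : closure (Ioo u v) = Icc u v :=
  _root_.closure_Ioo h.1.ne

theorem MaximalInterval.mem_closure_diff (h : MaximalInterval β u v) (he : e ∈ Icc u v)
    (he' : e ∉ Ioo u v) : e ∈ closure (((↑) : ℚ → ℝ) '' (ZN β \ purelyPeriodic β)) := by
  by_contra hcl
  obtain ⟨a, b, hab, hsub⟩ :=
    mem_nhds_iff_exists_Ioo_subset.1 (isClosed_closure.isOpen_compl.mem_nhds hcl)
  have hunion : Ioo u v ∪ Ioo a b = Ioo (min u a) (max v b) :=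
    Ioo_union_Ioo' (hab.1.trans_le he.2) (he.1.trans_lt hab.2)
  have hgood : GoodInterval β (min u a) (max v b) := by
    refine ⟨(min_le_left _ _).trans_lt (h.1.1.trans_le (le_max_left _ _)), fun q hq hmem => ?_⟩
    rw [← hunion] at hmem
    rcases hmem with hmem | hmem
    · exact h.1.2 q hq hmem
    · by_contra hqP
      exact hsub hmem (subset_closure (mem_image_of_mem _ ⟨hq, hqP⟩))
  rw [← h.2 _ _ (hunion ▸ subset_union_left) hgood, ← hunion] at he'
  exact he' (Or.inr hab)

end Pisot

end BetaNum

theorem mainTheorem7_general (β : ℝ) [BetaNum.IsPisot β] (u v : ℝ)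
    (h : BetaNum.GoodInterval β u v) :
    ((∀ q : ℚ, (q : ℝ) = v → v < 1 → BetaNum.IntegralAtBeta β q →
        q ∈ BetaNum.purelyPeriodic β) ∧
      (BetaNum.MaximalInterval β u v → v < 1 →
        BetaNum.CaseA β v ∨ BetaNum.CaseB β v ∨ BetaNum.CaseC β v)) ∧
    ((∀ q : ℚ, (q : ℝ) = u → 0 < u → BetaNum.IntegralAtBeta β q →
        q ∈ BetaNum.purelyPeriodic β) ∧
      (BetaNum.MaximalInterval β u v → 0 < u →
        BetaNum.CaseA β u ∨ BetaNum.CaseB β u ∨ BetaNum.CaseC β u)) := by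
  have hu : u ∈ Set.Icc u v := Set.left_mem_Icc.2 h.1.le
  have hv : v ∈ Set.Icc u v := Set.right_mem_Icc.2 h.1.le
  have endpoint_mem {q : ℚ} (hq : (q : ℝ) ∈ Set.Icc u v) (h0 : (0 : ℝ) < q) (h1 : (q : ℝ) < 1)
      (hint : BetaNum.IntegralAtBeta β q) : q ∈ BetaNum.purelyPeriodic β :=
    BetaNum.purelyPeriodic_of_mem_closure isOpen_Ioo h.2
      (BetaNum.mem_ZN_iff_integralAtBeta.2 hint) (h.closure_Ioo.symm ▸ hq)
      (by exact_mod_cast h0) (by exact_mod_cast h1)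
  have cases {e : ℝ} (hmax : BetaNum.MaximalInterval β u v) (he : e ∈ Set.Icc u v)
      (he' : e ∉ Set.Ioo u v) (h0 : 0 < e) (h1 : e < 1) :
      BetaNum.CaseA β e ∨ BetaNum.CaseB β e ∨ BetaNum.CaseC β e :=
    BetaNum.caseA_or_caseB_or_caseC_of_mem_closure isOpen_Ioo h.2 (h.closure_Ioo.symm ▸ he)
      (hmax.mem_closure_diff he he') h0 h1
  refine ⟨⟨?_, fun hmax hv1 => cases hmax hv (fun hv => hv.2.false) h.right_pos hv1⟩,
    ?_, fun hmax hu0 => cases hmax hu (fun hu => hu.1.false) hu0 h.left_lt_one⟩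
  · rintro q rfl hv1 hint
    exact endpoint_mem hv h.right_pos hv1 hint
  · rintro q rfl hu0 hint
    exact endpoint_mem hu hu0 h.left_lt_one hint

theorem mainTheorem7 (β : ℝ) [BetaNum.IsPisot β] (u v : ℝ)
    (h : BetaNum.GoodInterval β u v) :
    -- the right endpoint
    ((∀ q : ℚ, (q : ℝ) = v → v < 1 → q ∈ BetaNum.ZN β → q ∈ BetaNum.purelyPeriodic β) ∧
      (BetaNum.DensityCondition β →
        ∀ q : ℚ, (q : ℝ) = v → v < 1 → BetaNum.IntegralAtBeta β q →
          q ∈ BetaNum.purelyPeriodic β) ∧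
      (BetaNum.MaximalInterval β u v → v < 1 →
        BetaNum.CaseA β v ∨ BetaNum.CaseB β v ∨ BetaNum.CaseC β v)) ∧
    -- the left endpoint
    ((∀ q : ℚ, (q : ℝ) = u → 0 < u → q ∈ BetaNum.ZN β → q ∈ BetaNum.purelyPeriodic β) ∧
      (BetaNum.DensityCondition β →
        ∀ q : ℚ, (q : ℝ) = u → 0 < u → BetaNum.IntegralAtBeta β q →
          q ∈ BetaNum.purelyPeriodic β) ∧
      (BetaNum.MaximalInterval β u v → 0 < u →
        BetaNum.CaseA β u ∨ BetaNum.CaseB β u ∨ BetaNum.CaseC β u)) := by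
  obtain ⟨⟨hv, hvmax⟩, hu, humax⟩ := mainTheorem7_general β u v h
  simp only [BetaNum.mem_ZN_iff_integralAtBeta]
  exact ⟨⟨hv, fun _ => hv, hvmax⟩, hu, fun _ => hu, humax⟩
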